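/- An involution semigroup is an algebra $(S,\cdot,{}^*)$ of type $(2,1)$ whose multiplication is associative and which satisfies $(xy)^*=y^*x^*$ and $(x^*)^*=x$. For $n,m\ge 1$, define words $\mathbf v_{n,m}^{(h)}$, $h\ge1$, over the variables $x_{i_1i_2\cdots i_h}$ with $i_1,\dots,i_h\in\{1,\dots,2n\}$ by induction on $h$: \[ \mathbf v_{n,m}^{(1)}:=x_1x_2\cdots x_{2n}\,\bigl(x_nx_{n-1}\cdots x_1\cdot x_{n+1}x_{n+2}\cdots x_{2n}\bigr)^{2m-1}, \] and, for $h>1$, \[ \mathbf v_{n,m}^{(h)}:=\mathbf v_{n,m,1}^{(h-1)}\cdots\mathbf v_{n,m,2n}^{(h-1)}\,\bigl(\mathbf v_{n,m,n}^{(h-1)}\cdots\mathbf v_{n,m,1}^{(h-1)}\cdot\mathbf v_{n,m,n+1}^{(h-1)}\cdots\mathbf v_{n,m,2n}^{(h-1)}\bigr)^{2m-1}, \] where $\mathbf v_{n,m,j}^{(h-1)}$ is obtained from $\mathbf v_{n,m}^{(h-1)}$ by replacing each variable $x_{i_1\cdots i_{h-1}}$ by $x_{i_1\cdots i_{h-1}j}$.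 Let $(B_2^1,\cdot,{}^{-1})$ be the $6$-element Brandt monoid, formed by the zero-one matrices \[ \begin{pmatrix}0&0\\0&0\end{pmatrix},\ \begin{pmatrix}1&0\\0&1\end{pmatrix},\ \begin{pmatrix}0&1\\0&0\end{pmatrix},\ \begin{pmatrix}0&0\\1&0\end{pmatrix},\ \begin{pmatrix}1&0\\0&0\end{pmatrix},\ \begin{pmatrix}0&0\\0&1\end{pmatrix} \] under matrix multiplication, with matrix transposition as the involution ${}^{-1}$. Let $\mathcal S=(S,\cdot,{}^*)$ be an involution semigroup for which there exist $q,r\ge1$ such that the semigroup $(S,\cdot)$ satisfies the identities $\mathbf v_{n,q}^{(r)}=(\mathbf v_{n,q}^{(r)})^2$ for all $n\ge2$. If every identity of type $(2,1)$ that holds in $\mathcal S$ also holds in $(B_2^1,\cdot,{}^{-1})$, then the identities of $\mathcal S$ admit no finite basis; that is, there is no finite set $\Sigma$ of identities of $\mathcal S$ such that every identity of $\mathcal S$ holds in all algebras of type $(2,1)$ that satisfy $\Sigma$. -/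

import Mathlib

universe u v

namespace InvSemigroup

/-- Terms of type `(2,1)` (one binary and one unary operation) over the variables `x₀, x₁, x₂, …`. -/
inductive Term : Type
  | var : ℕ → Term
  | mul : Term → Term → Term
  | star : Term → Term

/-- The value of a term in an algebra of type `(2,1)` under an assignment of its variables. -/
def Term.eval {A : Type u} [Mul A] [Star A] (θ : ℕ → A) : Term → A
  | .var i => θ i
  | .mul s t => s.eval θ * t.eval θ
  | .star t => Star.star (t.eval θ)

/-- An identity of type `(2,1)`: a formal equality `lhs = rhs` of two terms. -/
structure Identity : Type where
  lhs : Term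
  rhs : Term

/-- The identity `e` holds in the algebra `A` of type `(2,1)`. -/
def Satisfies (A : Type u) [Mul A] [Star A] (e : Identity) : Prop :=
  ∀ θ : ℕ → A, e.lhs.eval θ = e.rhs.eval θ

/-- `B` is a basis for the identities of `S`: all members of `B` hold in `S`, and every identity
of `S` is a consequence of `B`, that is, holds in every algebra of type `(2,1)` in which all
members of `B` hold. -/
def IsIdentityBasis (S : Type u) [Mul S] [Star S] (B : Set Identity) : Prop :=
  (∀ e ∈ B, Satisfies S e) ∧
    ∀ e : Identity, Satisfies S e →
      ∀ (A : Type v) [Mul A] [Star A], (∀ b ∈ B, Satisfies A b) → Satisfies A e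

/-- The identities of `S` admit a finite basis. -/
def HasFiniteIdentityBasis (S : Type u) [Mul S] [Star S] : Prop :=
  ∃ B : Set Identity, B.Finite ∧ IsIdentityBasis.{u, v} S B

/-- Words over the variables `x_I`, where the index `I = i₁i₂⋯iₕ` is a string of numbers. -/
abbrev Word : Type := FreeMonoid (List ℕ)

/-- `f₁ f₂ ⋯ f₂ₙ (fₙ fₙ₋₁ ⋯ f₁ · fₙ₊₁ fₙ₊₂ ⋯ f₂ₙ) ^ (2m-1)`. -/
def vPattern {M : Type u} [Monoid M] (n m : ℕ) (f : ℕ → M) : M :=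
  ((List.range' 1 (2 * n)).map f).prod *
    (((List.range' 1 n).reverse.map f).prod * ((List.range' (n + 1) n).map f).prod) ^ (2 * m - 1)

/-- The substitution that appends `j` to the index of every variable. -/
def appendIndex (j : ℕ) : Word →* Word :=
  FreeMonoid.map fun I => I ++ [j]

/-- The words `v_{n,m}^{(h)}`, `h ≥ 1`. The recursion starts at the auxiliary value `h = 0`, a single
variable with empty index, so that the word for `h = 1` is the pattern in `x₁, …, x₂ₙ`. -/
def vWord (n m : ℕ) : ℕ → Word
  | 0 => FreeMonoid.of []
  | h + 1 => vPattern n m fun j => appendIndex j (vWord n m h)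

/-- The base case is the word `x₁ ⋯ x₂ₙ (xₙ ⋯ x₁ · xₙ₊₁ ⋯ x₂ₙ) ^ (2m-1)`. -/
theorem vWord_one (n m : ℕ) : vWord n m 1 = vPattern n m fun j => FreeMonoid.of [j] := rfl

/-- The semigroup `S` satisfies the identity `u = w` between semigroup words. Words are evaluated
in `S` with a new identity element adjoined; the value of a nonempty word lies in `S`. -/
def SatisfiesWords (S : Type u) [Semigroup S] (u w : Word) : Prop :=
  ∀ θ : List ℕ → S,
    FreeMonoid.lift (fun I => (θ I : WithOne S)) u =
      FreeMonoid.lift (fun I => (θ I : WithOne S)) w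

/-- The six zero-one matrices that form the Brandt monoid. -/
def brandtSet : Set (Matrix (Fin 2) (Fin 2) ℤ) :=
  {!![0, 0; 0, 0], !![1, 0; 0, 1], !![0, 1; 0, 0], !![0, 0; 1, 0], !![1, 0; 0, 0], !![0, 0; 0, 1]}

theorem brandtSet_mul_mem {a b : Matrix (Fin 2) (Fin 2) ℤ} (ha : a ∈ brandtSet)
    (hb : b ∈ brandtSet) : a * b ∈ brandtSet := by
  simp only [brandtSet, Set.mem_insert_iff, Set.mem_singleton_iff] at ha hb ⊢
  rcases ha with rfl | rfl | rfl | rfl | rfl | rfl <;>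
    rcases hb with rfl | rfl | rfl | rfl | rfl | rfl <;> decide

theorem brandtSet_transpose_mem {a : Matrix (Fin 2) (Fin 2) ℤ} (ha : a ∈ brandtSet) :
    a.transpose ∈ brandtSet := by
  simp only [brandtSet, Set.mem_insert_iff, Set.mem_singleton_iff] at ha ⊢
  rcases ha with rfl | rfl | rfl | rfl | rfl | rfl <;> decide

/-- The 6-element Brandt monoid `B₂¹` under matrix multiplication. -/
def Brandt : Subsemigroup (Matrix (Fin 2) (Fin 2) ℤ) where
  carrier := brandtSet
  mul_mem' := brandtSet_mul_mem

/-- The involution of `B₂¹` (inversion in this inverse semigroup) is matrix transposition. -/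
instance : StarMul Brandt where
  star a := ⟨a.1.transpose, brandtSet_transpose_mem a.2⟩
  star_involutive a := Subtype.ext a.1.transpose_transpose
  star_mul a b := Subtype.ext (Matrix.transpose_mul a.1 b.1)

end InvSemigroup

/-!
For every `k` there is an algebra of type `(2,1)` in which the identities of `B₂¹` in `k` variables
hold, but `v = v²` fails for `v = v_{n,m}^{(h)}` as soon as `n ≥ k + 2`. A finite basis of the
identities of `S` involves finitely many variables, and would hold in one of these algebras.

The members of the algebra are partial injections of a set of points with two distinguished ends,
under composition and converse. A two-colouring of the points may map all members occurring in a
term to elements of `B₂¹`; if there are enough such colourings to separate every point from the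
domain of every member, then they determine the value of the term, and the identities of `B₂¹`
carry over. If `v` takes a value that maps the first end to the second one, and no member is defined
at both ends, then this value is not idempotent.

For `h = 0` the relations that hold for at most one pair of the two ends will do. To pass from `h`
to `h + 1`, take a ladder-shaped digraph in which the pattern of the words labels a walk between two
vertices, and replace its edges by copies of the set of points for `h`. Any `k + 1 < n` labels miss
some `l < n`; both rails of the ladder can change their colours at the edges labelled `l`, which
leaves enough freedom for the two-colourings.
-/

namespace InvSemigroup

/-! ### Binary relations and their colourings -/

/-- The binary relations on `V`, as an involution monoid under composition and converse. -/
def BinRel (V : Type v) : Type v := V → V → Prop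

namespace BinRel

variable {V : Type v} {X : Type*} {f g : BinRel V} {x : V}

@[ext]
theorem ext (h : ∀ x y, f x y ↔ g x y) : f = g :=
  funext fun x => funext fun y => propext (h x y)

instance : Monoid (BinRel V) where
  mul := Relation.Comp
  one := Eq
  mul_assoc _ _ _ := Relation.comp_assoc
  one_mul _ := Relation.eq_comp
  mul_one _ := Relation.comp_eq

instance : Star (BinRel V) := ⟨flip⟩

theorem pow_apply_self (h : f x x) (m : ℕ) : (f ^ m) x x := by
  induction m with
  | zero => exact rfl
  | succ m ih => exact pow_succ f m ▸ ⟨x, ih, h⟩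

/-- The domain of a relation. -/
def dom (f : BinRel V) : Set V := {x | ∃ y, f x y}

/-- A relation is slim if it holds for at most one pair. -/
def IsSlim (f : BinRel V) : Prop := ∀ ⦃x y x' y'⦄, f x y → f x' y' → x = x' ∧ y = y'

theorem IsSlim.dom_subsingleton (hf : f.IsSlim) : f.dom.Subsingleton :=
  fun _ ⟨_, h⟩ _ ⟨_, h'⟩ => (hf h h').1

theorem IsSlim.star (hf : f.IsSlim) : (Star.star f).IsSlim := fun _ _ _ _ h h' => (hf h h').symm

theorem IsSlim.mul_of_rightUnique (hf : f.IsSlim) (hg : Relator.RightUnique g) :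
    (f * g).IsSlim := by
  rintro x z x' z' ⟨y, hxy, hyz⟩ ⟨y', hxy', hyz'⟩
  obtain ⟨rfl, rfl⟩ := hf hxy hxy'
  exact ⟨rfl, hg hyz hyz'⟩

theorem IsSlim.mul_of_leftUnique (hg : g.IsSlim) (hf : Relator.LeftUnique f) :
    (f * g).IsSlim := by
  rintro x z x' z' ⟨y, hxy, hyz⟩ ⟨y', hxy', hyz'⟩
  obtain ⟨rfl, rfl⟩ := hg hyz hyz'
  exact ⟨hf hxy hxy', rfl⟩

/-- The relation that holds for the pair `(x, y)` only. -/
def single (x y : V) : BinRel V := fun a b => a = x ∧ b = y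

theorem isSlim_single (x y : V) : (single x y).IsSlim := by
  rintro _ _ _ _ ⟨rfl, rfl⟩ ⟨rfl, rfl⟩
  exact ⟨rfl, rfl⟩

theorem dom_single (x y : V) : (single x y).dom = {x} := by
  ext a
  simp [dom, single]

/-- The image of a relation under a map of the points. -/
def map (c : V → X) (f : BinRel V) : BinRel X := Relation.Map f c c

theorem map_star (c : V → X) (f : BinRel V) : (Star.star f).map c = Star.star (f.map c) := by
  ext x y
  exact ⟨fun ⟨a, b, h, ha, hb⟩ => ⟨b, a, h, hb, ha⟩, fun ⟨a, b, h, ha, hb⟩ => ⟨b, a, h, hb, ha⟩⟩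

/-- A colouring is compatible with a relation if all related pairs are monochromatic, or if all
related pairs have the same first colour and the same second colour. For two colours this says that
the image of the relation on the colours is one of the six elements of the Brandt monoid. -/
def IsCompatible (c : V → X) (f : BinRel V) : Prop :=
  (∀ x y, f x y → c x = c y) ∨ ∃ a a', ∀ x y, f x y → c x = a ∧ c y = a'

theorem isCompatible_const (a : X) (f : BinRel V) : IsCompatible (fun _ => a) f :=
  .inl fun _ _ _ => rfl

theorem IsSlim.isCompatible (hf : f.IsSlim) (c : V → X) : IsCompatible c f := by
  by_cases h : ∃ x y, f x y
  · obtain ⟨x, y, hxy⟩ := h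
    refine .inr ⟨c x, c y, fun x' y' h' => ?_⟩
    obtain ⟨rfl, rfl⟩ := hf hxy h'
    exact ⟨rfl, rfl⟩
  · push Not at h
    exact .inl fun x y hxy => absurd hxy (h x y)

theorem IsCompatible.comp {Y : Type*} {c : V → X} (h : IsCompatible c f) (φ : X → Y) :
    IsCompatible (φ ∘ c) f :=
  h.imp (fun h x y hxy => congrArg φ (h x y hxy)) fun ⟨a, a', h⟩ =>
    ⟨φ a, φ a', fun x y hxy => ⟨congrArg φ (h x y hxy).1, congrArg φ (h x y hxy).2⟩⟩

theorem IsCompatible.map {c : V → X} (h : IsCompatible c f) : IsCompatible id (f.map c) := by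
  rcases h with h | ⟨a, a', h⟩
  · refine .inl ?_
    rintro _ _ ⟨x, y, hxy, rfl, rfl⟩
    exact h x y hxy
  · refine .inr ⟨a, a', ?_⟩
    rintro _ _ ⟨x, y, hxy, rfl, rfl⟩
    exact h x y hxy

end BinRel

open BinRel

/-! ### Frames -/

/-- A frame `T` is an involution semigroup of partial injections, with two distinguished points
`o false` and `o true` (the ends), which locally cannot be told from the Brandt monoid: for any `k`
of its members, enough two-colourings of the points are compatible with all of them. -/
structure IsFrame {V : Type v} (k : ℕ) (o : Bool → V) (T : Set (BinRel V)) : Prop where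
  injective : Function.Injective o
  mem_of_isSlim : ∀ f : BinRel V, f.IsSlim → f ∈ T
  mul_mem : ∀ f ∈ T, ∀ g ∈ T, f * g ∈ T
  star_mem : ∀ f ∈ T, Star.star f ∈ T
  rightUnique : ∀ f ∈ T, Relator.RightUnique f
  exists_notMem_dom : ∀ f ∈ T, ∃ p, o p ∉ f.dom
  sep : ∀ R ⊆ T, R.encard ≤ k → ∀ f ∈ T, ∀ x ∉ f.dom,
    ∃ c : V → Bool, (∀ h ∈ R, IsCompatible c h) ∧ c x = true ∧ ∀ y ∈ f.dom, c y = false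
  sep_inner : ∀ R ⊆ T, R.encard ≤ k → ∀ x ∉ Set.range o,
    ∃ c : V → Bool, (∀ h ∈ R, IsCompatible c h) ∧ c x = true ∧ ∀ p, c (o p) = false
  sep_end : ∀ R ⊆ T, R.encard ≤ k → ∀ f ∈ T, ∀ p, o p ∉ f.dom →
    ∃ c : V → Bool, (∀ h ∈ R, IsCompatible c h) ∧ (∀ q, c (o q) = (q == p)) ∧
      ∀ y ∈ f.dom, c y = false

theorem IsFrame.eq_of_mem_dom {V : Type v} {k : ℕ} {o : Bool → V} {T : Set (BinRel V)}
    (hT : IsFrame k o T) {f : BinRel V} (hf : f ∈ T) {p p' : Bool} (hp : o p ∈ f.dom)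
    (hp' : o p' ∈ f.dom) : p = p' := by
  obtain ⟨q, hq⟩ := hT.exists_notMem_dom f hf
  have hpq : p ≠ q := fun h => hq (h ▸ hp)
  have hpq' : p' ≠ q := fun h => hq (h ▸ hp')
  exact (Bool.eq_not_of_ne hpq).trans (Bool.eq_not_of_ne hpq').symm

theorem isFrame_isSlim (k : ℕ) : IsFrame k ULift.up.{v} {f | f.IsSlim} where
  injective := ULift.up_injective
  mem_of_isSlim _ hf := hf
  mul_mem _ hf _ hg := IsSlim.mul_of_rightUnique hf fun _ _ _ h h' => (hg h h').2
  star_mem _ hf := IsSlim.star hf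
  rightUnique _ hf _ _ _ h h' := (hf h h').2
  exists_notMem_dom f hf := by
    by_contra! h
    exact absurd (IsSlim.dom_subsingleton hf (h false) (h true)) (by simp)
  sep R hR _ f _ x hx := by
    classical
    refine ⟨fun y => decide (y = x), fun h hh => IsSlim.isCompatible (hR hh) _, by simp, ?_⟩
    rintro y hy
    simpa using ne_of_mem_of_not_mem hy hx
  sep_inner _ _ _ x hx := absurd ⟨x.down, rfl⟩ hx
  sep_end R hR _ f _ p hp := by
    refine ⟨fun y => y.down == p, fun h hh => IsSlim.isCompatible (hR hh) _, fun _ => rfl, ?_⟩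
    rintro ⟨q⟩ hy
    simpa using fun h : q = p => hp (h ▸ hy)

/-! ### Labelled digraphs -/

/-- A digraph on the vertices `W` with edges `E` that are labelled by `L`; `vertex e false` is the
source and `vertex e true` the target of the edge `e`. -/
structure LabeledDigraph (W E L : Type*) where
  vertex : E → Bool → W
  label : E → L

namespace LabeledDigraph

variable {W E L X : Type*} {G : LabeledDigraph W E L} {b : W → X} {j : L}

/-- The relation on the vertices that consists of the edges with label `j`. -/
def rel (G : LabeledDigraph W E L) (j : L) : BinRel W :=
  fun x y => ∃ e, G.label e = j ∧ G.vertex e false = x ∧ G.vertex e true = y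

/-- All edges with label `j` have ends of the colours `γ false` and `γ true`. -/
def HasEnds (G : LabeledDigraph W E L) (b : W → X) (j : L) (γ : Bool → X) : Prop :=
  ∀ e, G.label e = j → ∀ p, b (G.vertex e p) = γ p

theorem isCompatible_rel_iff : IsCompatible b (G.rel j) ↔
    (∀ e, G.label e = j → ∀ p, b (G.vertex e p) = b (G.vertex e true)) ∨
      ∃ γ, G.HasEnds b j γ := by
  refine or_congr ⟨fun h e he => ?_, ?_⟩ ⟨?_, fun ⟨γ, h⟩ => ⟨γ false, γ true, ?_⟩⟩
  · exact Bool.forall_bool.2 ⟨h _ _ ⟨e, he, rfl, rfl⟩, rfl⟩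
  · rintro h _ _ ⟨e, he, rfl, rfl⟩
    exact h e he false
  · rintro ⟨a, a', h⟩
    exact ⟨(bif · then a' else a), fun e he =>
      Bool.forall_bool.2 (h _ _ ⟨e, he, rfl, rfl⟩)⟩
  · rintro _ _ ⟨e, he, rfl, rfl⟩
    exact ⟨h e he false, h e he true⟩

/-- The conditions under which the edges of a labelled digraph with ends `o` can be replaced by
copies of a frame, with any `k` labels in view: edges meet so rarely that the new relations are
again closed under composition, and there are many two-colourings compatible with all of the `k`
labels. -/
structure Admissible (G : LabeledDigraph W E L) (k : ℕ) (o : Bool → W) : Prop where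
  injective : Function.Injective o
  matching : ∀ ⦃e e' p p'⦄, G.label e = G.label e' → G.vertex e p = G.vertex e' p' →
    e = e' ∧ p = p'
  meet : ∀ ⦃e₁ e₂ e₁' e₂' p p'⦄, G.label e₁ = G.label e₂ → G.label e₁' = G.label e₂' →
    G.label e₁ ≠ G.label e₁' → G.vertex e₁ p = G.vertex e₁' p' → G.vertex e₂ p = G.vertex e₂' p' →
    e₁ = e₂
  ends : ∀ ⦃e e' p⦄, G.label e = G.label e' → G.vertex e p = o false → G.vertex e' p ≠ o true
  sep : ∀ K : Set L, K.encard ≤ k → ∀ w w', w ≠ w' →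
    ∃ b : W → Bool, (∀ j ∈ K, IsCompatible b (G.rel j)) ∧ b w = true ∧ b w' = false ∧
      ∀ q, w = o q → b (o !q) = false
  sep_inner : ∀ K : Set L, K.encard ≤ k → ∀ w ∉ Set.range o,
    ∃ b : W → Bool, (∀ j ∈ K, IsCompatible b (G.rel j)) ∧ b w = true ∧ ∀ q, b (o q) = false
  sep_edge : ∀ K : Set L, K.encard ≤ k → ∀ e e', G.label e ∈ K → G.label e = G.label e' → e ≠ e' →
    ∃ b : W → Bool, (∀ j ∈ K, IsCompatible b (G.rel j)) ∧ (∀ p, b (G.vertex e p) = true) ∧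
      ∀ p, b (G.vertex e' p) = false
  sep_label : ∀ K : Set L, K.encard ≤ k → ∀ j ∈ K, ∀ w p,
    (∀ e p', G.label e = j → G.vertex e p' = w → p' = p) →
    ∃ b : W → Bool, (∀ j ∈ K, IsCompatible b (G.rel j)) ∧ b w = true ∧
      (∀ q, w = o q → b (o !q) = false) ∧
      (G.HasEnds b j (fun _ => false) ∨ G.HasEnds b j (· == p))

theorem Admissible.exists_hasEnds {k : ℕ} {o : Bool → W} (hG : G.Admissible k o) {K : Set L}
    (hK : K.encard ≤ k) (hj : j ∈ K) (γ : Bool → Bool) :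
    ∃ b : W → Bool, (∀ i ∈ K, IsCompatible b (G.rel i)) ∧ G.HasEnds b j γ := by
  by_cases he : ∃ e, G.label e = j
  swap
  · push Not at he
    exact ⟨fun _ => true, fun _ _ => isCompatible_const _ _, fun e h => absurd h (he e)⟩
  obtain ⟨e, he⟩ := he
  by_cases hγ : ∀ p, γ p = γ true
  · exact ⟨fun _ => γ true, fun _ _ => isCompatible_const _ _, fun _ _ p => (hγ p).symm⟩
  obtain ⟨p, hp⟩ : ∃ p, γ = (· == p) := by revert hγ; revert γ; decide
  obtain ⟨b, hb, hw, -, h | h⟩ := hG.sep_label K hK j hj (G.vertex e p) p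
    fun e' p' he' h => (hG.matching (he'.trans he.symm) h).2
  · exact absurd (hw.symm.trans (h e he p)) (by simp)
  · exact ⟨b, hb, hp ▸ h⟩

end LabeledDigraph

/-! ### Replacing edges by frames -/

/-- The points of the digraph obtained by replacing every edge `e` with a copy of `V`: the vertices
of the digraph and, for every edge, the points of `V` other than the two ends. -/
inductive Replacement (W E : Type*) {V : Type*} (o : Bool → V)
  | base (w : W)
  | inner (e : E) (x : V) (hx : x ∉ Set.range o)

namespace Replacement

variable {W E L : Type*} {V : Type v} {o : Bool → V} {G : LabeledDigraph W E L} {oW : Bool → W}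
  {T : Set (BinRel V)} {k k' : ℕ} {e e' : E} {x y z : V} {w : W} {i j : L} {f g : BinRel V}
  {K : Set L} {R' : Set (BinRel V)} {R : Set (BinRel (Replacement W E o))}
  {X Z : Replacement W E o}

open Classical in
/-- The copy of `V` on the edge `e`; the ends of `V` go to the ends of the edge. -/
noncomputable def embed (G : LabeledDigraph W E L) (o : Bool → V) (e : E) (x : V) :
    Replacement W E o :=
  if hx : x ∈ Set.range o then base (G.vertex e hx.choose) else inner e x hx

theorem embed_end (ho : Function.Injective o) (e : E) (p : Bool) :
    embed G o e (o p) = base (G.vertex e p) := by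
  have hp : o p ∈ Set.range o := ⟨p, rfl⟩
  rw [embed, dif_pos hp, ho hp.choose_spec]

theorem embed_of_notMem (hx : x ∉ Set.range o) : embed G o e x = inner e x hx := dif_neg hx

theorem exists_of_embed_eq_base (ho : Function.Injective o) (h : embed G o e x = base w) :
    ∃ p, x = o p ∧ G.vertex e p = w := by
  by_cases hx : x ∈ Set.range o
  · obtain ⟨p, rfl⟩ := hx
    exact ⟨p, rfl, base.inj ((embed_end ho e p).symm.trans h)⟩
  · simp [embed_of_notMem hx] at h

theorem eq_or_exists_of_embed_eq_embed (ho : Function.Injective o)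
    (h : embed G o e x = embed G o e' y) :
    (e = e' ∧ x = y) ∨ ∃ p p', x = o p ∧ y = o p' ∧ G.vertex e p = G.vertex e' p' := by
  by_cases hx : x ∈ Set.range o
  · obtain ⟨p, rfl⟩ := hx
    rw [embed_end ho] at h
    obtain ⟨p', hy, hp'⟩ := exists_of_embed_eq_base ho h.symm
    exact .inr ⟨p, p', rfl, hy, hp'.symm⟩
  by_cases hy : y ∈ Set.range o
  · obtain ⟨p', rfl⟩ := hy
    rw [embed_end ho] at h
    obtain ⟨p, hx', hp⟩ := exists_of_embed_eq_base ho h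
    exact .inr ⟨p, p', hx', rfl, hp⟩
  · rw [embed_of_notMem hx, embed_of_notMem hy] at h
    injection h with he hxy
    exact .inl ⟨he, hxy⟩

theorem eq_of_embed_eq_embed (hG : G.Admissible k oW) (ho : Function.Injective o)
    (hl : G.label e = G.label e') (h : embed G o e x = embed G o e' y) : e = e' ∧ x = y := by
  rcases eq_or_exists_of_embed_eq_embed ho h with hxy | ⟨p, p', rfl, rfl, hp⟩
  · exact hxy
  · exact (hG.matching hl hp).imp_right (congrArg o)

/-- The relation `g` on all copies of `V` that replace edges with label `j`. -/
def spread (G : LabeledDigraph W E L) (o : Bool → V) (j : L) (g : BinRel V) :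
    BinRel (Replacement W E o) :=
  fun X Y => ∃ e x y, G.label e = j ∧ embed G o e x = X ∧ embed G o e y = Y ∧ g x y

theorem embed_mem_dom_spread (hG : G.Admissible k oW) (ho : Function.Injective o)
    (hj : G.label e = j) : embed G o e x ∈ (spread G o j g).dom ↔ x ∈ g.dom := by
  constructor
  · rintro ⟨_, e', x', y, hj', hx, -, hxy⟩
    obtain ⟨rfl, rfl⟩ := eq_of_embed_eq_embed hG ho (hj'.trans hj.symm) hx
    exact ⟨y, hxy⟩
  · rintro ⟨y, hxy⟩
    exact ⟨_, e, x, y, hj, rfl, rfl, hxy⟩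

theorem star_spread : Star.star (spread G o j g) = spread G o j (Star.star g) := by
  ext X Y
  exact ⟨fun ⟨e, x, y, hj, hx, hy, h⟩ => ⟨e, y, x, hj, hy, hx, h⟩,
    fun ⟨e, x, y, hj, hx, hy, h⟩ => ⟨e, y, x, hj, hy, hx, h⟩⟩

theorem rightUnique_spread (hG : G.Admissible k oW) (ho : Function.Injective o)
    (hg : Relator.RightUnique g) : Relator.RightUnique (spread G o j g) := by
  rintro _ _ _ ⟨e, x, y, hj, rfl, rfl, hxy⟩ ⟨e', x', y', hj', hx, rfl, hxy'⟩
  obtain ⟨rfl, rfl⟩ := eq_of_embed_eq_embed hG ho (hj'.trans hj.symm) hx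
  rw [hg hxy hxy']

theorem spread_mul_spread (hG : G.Admissible k oW) (ho : Function.Injective o) :
    spread G o j f * spread G o j g = spread G o j (f * g) := by
  ext X Z
  constructor
  · rintro ⟨_, ⟨e, x, y, hj, rfl, rfl, hxy⟩, e', y', z, hj', hy, rfl, hyz⟩
    obtain ⟨rfl, rfl⟩ := eq_of_embed_eq_embed hG ho (hj'.trans hj.symm) hy
    exact ⟨e', x, z, hj, rfl, rfl, y', hxy, hyz⟩
  · rintro ⟨e, x, z, hj, rfl, rfl, y, hxy, hyz⟩
    exact ⟨_, ⟨e, x, y, hj, rfl, rfl, hxy⟩, e, y, z, hj, rfl, rfl, hyz⟩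

theorem isSlim_spread_mul_spread (hG : G.Admissible k oW) (hT : IsFrame k' o T) (hf : f ∈ T)
    (hg : g ∈ T) (hij : i ≠ j) : (spread G o i f * spread G o j g).IsSlim := by
  have ho := hT.injective
  rintro _ _ _ _ ⟨_, ⟨e₁, x₁, y₁, hi₁, rfl, rfl, h₁⟩, e₁', y₁', z₁, hj₁, hy₁, rfl, h₁'⟩
    ⟨_, ⟨e₂, x₂, y₂, hi₂, rfl, rfl, h₂⟩, e₂', y₂', z₂, hj₂, hy₂, rfl, h₂'⟩
  have hi : G.label e₁ = G.label e₂ := hi₁.trans hi₂.symm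
  have hj : G.label e₁' = G.label e₂' := hj₁.trans hj₂.symm
  have hne : G.label e₁ ≠ G.label e₁' := by rwa [hi₁, hj₁]
  rcases eq_or_exists_of_embed_eq_embed ho hy₁ with ⟨rfl, -⟩ | ⟨p₁', p₁, rfl, rfl, hp₁⟩
  · exact absurd rfl hne
  rcases eq_or_exists_of_embed_eq_embed ho hy₂ with ⟨rfl, -⟩ | ⟨p₂', p₂, rfl, rfl, hp₂⟩
  · exact absurd (hi.trans hj.symm) hne
  obtain rfl := hT.eq_of_mem_dom (hT.star_mem f hf) ⟨x₁, h₁⟩ ⟨x₂, h₂⟩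
  obtain rfl := hT.eq_of_mem_dom hg ⟨z₁, h₁'⟩ ⟨z₂, h₂'⟩
  obtain rfl := hG.meet hi hj hne hp₁.symm hp₂.symm
  obtain rfl := hG.meet hj hi hne.symm hp₁ hp₂
  rw [hT.rightUnique _ (hT.star_mem f hf) h₁ h₂, hT.rightUnique g hg h₁' h₂']
  exact ⟨rfl, rfl⟩

/-- The relations that result from those in `T` when edges are replaced: besides the slim ones, all
relations of `T` on the edges of one label, which is taken from `K`. -/
def spreadSet (G : LabeledDigraph W E L) (o : Bool → V) (K : Set L) (T : Set (BinRel V)) :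
    Set (BinRel (Replacement W E o)) :=
  {h | h.IsSlim ∨ ∃ j ∈ K, ∃ g ∈ T, h = spread G o j g}

theorem star_mem_spreadSet (hT : IsFrame k o T) {h : BinRel (Replacement W E o)}
    (hh : h ∈ spreadSet G o K T) : Star.star h ∈ spreadSet G o K T := by
  rcases hh with hh | ⟨j, hj, g, hg, rfl⟩
  · exact .inl hh.star
  · exact .inr ⟨j, hj, _, hT.star_mem g hg, star_spread⟩

theorem rightUnique_of_mem_spreadSet (hG : G.Admissible k oW) (hT : IsFrame k' o T)
    {h : BinRel (Replacement W E o)} (hh : h ∈ spreadSet G o K T) : Relator.RightUnique h := by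
  rcases hh with hh | ⟨j, -, g, hg, rfl⟩
  · exact fun _ _ _ h₁ h₂ => (hh h₁ h₂).2
  · exact rightUnique_spread hG hT.injective (hT.rightUnique g hg)

theorem mul_mem_spreadSet (hG : G.Admissible k oW) (hT : IsFrame k' o T)
    {h h' : BinRel (Replacement W E o)} (hh : h ∈ spreadSet G o K T)
    (hh' : h' ∈ spreadSet G o K T) : h * h' ∈ spreadSet G o K T := by
  have hu := rightUnique_of_mem_spreadSet hG hT (star_mem_spreadSet hT hh)
  have hu' := rightUnique_of_mem_spreadSet hG hT hh'
  rcases hh with hs | ⟨i, hi, f, hf, rfl⟩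
  · exact .inl (hs.mul_of_rightUnique hu')
  rcases hh' with hs' | ⟨j, hj, g, hg, rfl⟩
  · exact .inl (hs'.mul_of_leftUnique fun _ _ _ h h' => hu h h')
  rcases eq_or_ne i j with rfl | hij
  · exact .inr ⟨i, hi, f * g, hT.mul_mem f hf g hg, spread_mul_spread hG hT.injective⟩
  · exact .inl (isSlim_spread_mul_spread hG hT hf hg hij)

theorem base_mem_dom_spread (hG : G.Admissible k oW) (ho : Function.Injective o) :
    base w ∈ (spread G o j g).dom ↔ ∃ e p, G.label e = j ∧ G.vertex e p = w ∧ o p ∈ g.dom := by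
  constructor
  · rintro ⟨_, e, x, y, hj, hx, -, hxy⟩
    obtain ⟨p, rfl, hp⟩ := exists_of_embed_eq_base ho hx
    exact ⟨e, p, hj, hp, y, hxy⟩
  · rintro ⟨e, p, hj, rfl, hp⟩
    rwa [← embed_end ho, embed_mem_dom_spread hG ho hj]

theorem exists_end_notMem_dom (hG : G.Admissible k oW) (hT : IsFrame k' o T)
    {h : BinRel (Replacement W E o)} (hh : h ∈ spreadSet G o K T) : ∃ q, base (oW q) ∉ h.dom := by
  by_contra! hcon
  rcases hh with hh | ⟨j, -, g, hg, rfl⟩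
  · exact absurd (hG.injective (base.inj (hh.dom_subsingleton (hcon false) (hcon true)))) (by simp)
  · have hend (q) := (base_mem_dom_spread hG hT.injective).1 (hcon q)
    obtain ⟨e, p, he, hp, hpg⟩ := hend false
    obtain ⟨e', p', he', hp', hpg'⟩ := hend true
    obtain rfl := hT.eq_of_mem_dom hg hpg hpg'
    exact hG.ends (he.trans he'.symm) hp hp'

theorem exists_subset_spreadSet (hT : IsFrame k o T) (hR : R ⊆ spreadSet G o Set.univ T)
    (hRk : R.encard ≤ k) (j : L) : ∃ K R', j ∈ K ∧ K.encard ≤ ((k + 1 : ℕ) : ℕ∞) ∧ R' ⊆ T ∧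
      R'.encard ≤ k ∧ R ⊆ spreadSet G o K R' := by
  have hchoice (h : BinRel (Replacement W E o)) :
      ∃ i, ∃ g ∈ T, h ∈ R → h.IsSlim ∨ h = spread G o i g := by
    by_cases hh : h ∈ R ∧ ¬h.IsSlim
    · obtain ⟨i, -, g, hg, hh⟩ := (hR hh.1).resolve_left hh.2
      exact ⟨i, g, hg, fun _ => .inr hh⟩
    · exact ⟨j, _, hT.mem_of_isSlim _ (isSlim_single (o true) (o true)),
        fun hR => .inl (by_contra fun hs => hh ⟨hR, hs⟩)⟩
  choose lab rel hrel hlab using hchoice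
  refine ⟨insert j (lab '' R), rel '' R, Set.mem_insert _ _, ?_, ?_,
    (Set.encard_image_le _ _).trans hRk, fun h hh => ?_⟩
  · calc (insert j (lab '' R)).encard ≤ (lab '' R).encard + 1 := Set.encard_insert_le _ _
      _ ≤ k + 1 := by gcongr; exact (Set.encard_image_le _ _).trans hRk
      _ = ((k + 1 : ℕ) : ℕ∞) := by push_cast; rfl
  · rintro _ ⟨h, -, rfl⟩
    exact hrel h
  · exact (hlab h hh).imp_right fun heq => ⟨lab h, .inr ⟨h, hh, rfl⟩, rel h, ⟨h, hh, rfl⟩, heq⟩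

/-- The colouring with `b` on the vertices and with `D e` on the inner points of the copy of `V` on
the edge `e`. -/
def glue (b : W → Bool) (D : E → V → Bool) : Replacement W E o → Bool
  | base w => b w
  | inner e x _ => D e x

theorem glue_embed (ho : Function.Injective o) {b : W → Bool} {D : E → V → Bool}
    (hD : ∀ e p, D e (o p) = b (G.vertex e p)) (e : E) (x : V) :
    glue b D (embed G o e x) = D e x := by
  by_cases hx : x ∈ Set.range o
  · obtain ⟨p, rfl⟩ := hx
    rw [embed_end ho, hD, glue]
  · rw [embed_of_notMem hx, glue]

theorem isCompatible_glue_spread (ho : Function.Injective o) {b : W → Bool} {D : E → V → Bool}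
    (hD : ∀ e p, D e (o p) = b (G.vertex e p))
    (h : (∀ e, G.label e = j → ∀ x y, D e x = D e y) ∨
      ∃ C, IsCompatible C g ∧ ∀ e, G.label e = j → D e = C) :
    IsCompatible (glue b D) (spread G o j g) := by
  rcases h with h | ⟨C, hC | ⟨a, a', hC⟩, h⟩
  · refine .inl ?_
    rintro _ _ ⟨e, x, y, he, rfl, rfl, -⟩
    rw [glue_embed ho hD, glue_embed ho hD, h e he x y]
  · refine .inl ?_
    rintro _ _ ⟨e, x, y, he, rfl, rfl, hxy⟩
    rw [glue_embed ho hD, glue_embed ho hD, h e he, hC x y hxy]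
  · refine .inr ⟨a, a', ?_⟩
    rintro _ _ ⟨e, x, y, he, rfl, rfl, hxy⟩
    rw [glue_embed ho hD, glue_embed ho hD, h e he]
    exact hC x y hxy

theorem exists_filling (hT : IsFrame k o T) (hR' : R' ⊆ T) (hk : R'.encard ≤ k) (z : V)
    (γ : Bool → Bool) : ∃ C : V → Bool, (∀ g ∈ R', IsCompatible C g) ∧ (∀ p, C (o p) = γ p) ∧
      (γ false = γ true → ∀ x, C x = γ true) ∧
        (z ∉ Set.range o → ∀ p, γ p = false → C z = false) := by
  by_cases hγ : γ false = γ true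
  · have hγ' : ∀ p, γ p = γ true := Bool.forall_bool.2 ⟨hγ, rfl⟩
    exact ⟨fun _ => γ true, fun _ _ => isCompatible_const _ _, fun p => (hγ' p).symm,
      fun _ _ => rfl, fun _ p hp => (hγ' p).symm.trans hp⟩
  obtain ⟨p, rfl⟩ : ∃ p, γ = (· == p) := by revert γ; decide
  obtain ⟨f, hf, hpf, hzf⟩ : ∃ f ∈ T, o p ∉ f.dom ∧ (z ∉ Set.range o → z ∈ f.dom) := by
    by_cases hz : z ∈ Set.range o
    · refine ⟨single (o !p) (o !p), hT.mem_of_isSlim _ (isSlim_single _ _), ?_, absurd hz⟩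
      simp [dom_single, hT.injective.eq_iff]
    · refine ⟨single z z, hT.mem_of_isSlim _ (isSlim_single _ _), ?_, fun _ => by simp [dom_single]⟩
      simpa [dom_single] using fun h : o p = z => hz ⟨p, h⟩
  obtain ⟨C, hC, hCo, hCf⟩ := hT.sep_end R' hR' hk f hf p hpf
  exact ⟨C, hC, hCo, fun h => absurd h hγ, fun hz _ _ => hCf z (hzf hz)⟩

/-- The copies on edges with a label in `J` get the colouring `C`. On every other copy the colouring
is chosen by the colours of the two ends alone: hence all copies for a label whose edges have the
same end colours are coloured alike, and copies on monochromatic edges are monochromatic. -/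
theorem exists_extension (hT : IsFrame k o T) (hR' : R' ⊆ T) (hk : R'.encard ≤ k)
    (hR : R ⊆ spreadSet G o K R') {b : W → Bool} (hb : ∀ j ∈ K, IsCompatible b (G.rel j))
    {J : Set L} {C : V → Bool} (hC : ∀ g ∈ R', IsCompatible C g)
    (hJ : ∀ j ∈ J, G.HasEnds b j (C ∘ o)) (z : V) :
    ∃ c : Replacement W E o → Bool, (∀ h ∈ R, IsCompatible c h) ∧ (∀ w, c (base w) = b w) ∧
      (∀ e, G.label e ∈ J → ∀ x, c (embed G o e x) = C x) ∧
      ∀ e, G.label e ∉ J →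
        (b (G.vertex e false) = b (G.vertex e true) →
          ∀ x, c (embed G o e x) = b (G.vertex e true)) ∧
        (z ∉ Set.range o → ∀ p, b (G.vertex e p) = false → c (embed G o e z) = false) := by
  classical
  choose Φ hΦ hΦo hΦconst hΦz using exists_filling hT hR' hk z
  let D (e : E) : V → Bool := if G.label e ∈ J then C else Φ fun p => b (G.vertex e p)
  have hDJ {e} (he : G.label e ∈ J) : D e = C := if_pos he
  have hDΦ {e} (he : G.label e ∉ J) : D e = Φ fun p => b (G.vertex e p) := if_neg he
  have hDo (e p) : D e (o p) = b (G.vertex e p) := by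
    by_cases he : G.label e ∈ J
    · exact (congrFun (hDJ he) _).trans (hJ _ he e rfl p).symm
    · rw [hDΦ he, hΦo]
  have hDconst {e} (he : G.label e ∉ J) (hmono : b (G.vertex e false) = b (G.vertex e true)) (x) :
      D e x = b (G.vertex e true) := by
    rw [hDΦ he]
    exact hΦconst _ hmono x
  have hglue := glue_embed (G := G) hT.injective hDo
  refine ⟨glue b D, fun h hh => ?_, fun w => rfl, fun e he x => by rw [hglue, hDJ he],
    fun e he => ⟨fun hmono x => by rw [hglue, hDconst he hmono], fun hz p hp => ?_⟩⟩
  · rcases hR hh with hs | ⟨j, hj, g, hg, rfl⟩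
    · exact hs.isCompatible _
    refine isCompatible_glue_spread hT.injective hDo ?_
    by_cases hjJ : j ∈ J
    · exact .inr ⟨C, hC g hg, fun e he => hDJ (he ▸ hjJ)⟩
    rcases LabeledDigraph.isCompatible_rel_iff.1 (hb j hj) with hmono | ⟨γ, hγ⟩
    · refine .inl fun e he x y => ?_
      rw [hDconst (he ▸ hjJ) (hmono e he false), hDconst (he ▸ hjJ) (hmono e he false)]
    · exact .inr ⟨Φ γ, hΦ γ g hg, fun e he => by rw [hDΦ (he ▸ hjJ), funext (hγ e he)]⟩
  · rw [hglue, hDΦ he]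
    exact hΦz _ hz p hp

theorem exists_coloring_inner (hT : IsFrame k o T) (hR' : R' ⊆ T) (hk : R'.encard ≤ k)
    (hR : R ⊆ spreadSet G o K R') (e : E) (hx : x ∉ Set.range o) :
    ∃ c : Replacement W E o → Bool, (∀ h ∈ R, IsCompatible c h) ∧ c (embed G o e x) = true ∧
      (∀ w, c (base w) = false) ∧
      ∀ e' y, G.label e' ≠ G.label e → c (embed G o e' y) = false := by
  obtain ⟨C, hC, hCx, hCo⟩ := hT.sep_inner R' hR' hk x hx
  obtain ⟨c, hc, hcb, hcJ, hcne⟩ := exists_extension hT hR' hk hR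
    (b := fun _ => false) (J := {G.label e}) (fun _ _ => isCompatible_const _ _) hC
    (fun _ _ _ _ p => (hCo p).symm) x
  exact ⟨c, hc, (hcJ e rfl x).trans hCx, hcb, fun e' y he' => (hcne e' he').1 rfl y⟩

theorem exists_coloring_label (hT : IsFrame k o T) (hG : G.Admissible k' oW) (hR' : R' ⊆ T)
    (hk : R'.encard ≤ k) (hK : K.encard ≤ k') (hR : R ⊆ spreadSet G o K R') (hj : j ∈ K)
    {C : V → Bool} (hC : ∀ g ∈ R', IsCompatible C g) :
    ∃ c : Replacement W E o → Bool, (∀ h ∈ R, IsCompatible c h) ∧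
      ∀ e, G.label e = j → ∀ x, c (embed G o e x) = C x := by
  obtain ⟨b, hb, hbj⟩ := hG.exists_hasEnds hK hj (C ∘ o)
  obtain ⟨c, hc, -, hcJ, -⟩ := exists_extension hT hR' hk hR hb (J := {j}) hC
    (by rintro _ rfl; exact hbj) (o true)
  exact ⟨c, hc, hcJ⟩

theorem exists_coloring_base (hT : IsFrame k o T) (hG : G.Admissible k' oW) (hR' : R' ⊆ T)
    (hk : R'.encard ≤ k) (hK : K.encard ≤ k') (hR : R ⊆ spreadSet G o K R') (hj : j ∈ K)
    (hg : g ∈ T) (hw : base w ∉ (spread G o j g).dom) :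
    ∃ c : Replacement W E o → Bool, (∀ h ∈ R, IsCompatible c h) ∧ c (base w) = true ∧
      (∀ q, w = oW q → c (base (oW !q)) = false) ∧ ∀ Y ∈ (spread G o j g).dom, c Y = false := by
  obtain ⟨p, hpg, hpw⟩ :
      ∃ p, o p ∉ g.dom ∧ ∀ e p', G.label e = j → G.vertex e p' = w → p' = p := by
    by_cases hmeet : ∃ e p, G.label e = j ∧ G.vertex e p = w
    · obtain ⟨e, p, he, rfl⟩ := hmeet
      exact ⟨p, fun hp => hw ((base_mem_dom_spread hG hT.injective).2 ⟨e, p, he, rfl, hp⟩),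
        fun e' p' he' h => (hG.matching (he'.trans he.symm) h).2⟩
    · push Not at hmeet
      obtain ⟨p, hp⟩ := hT.exists_notMem_dom g hg
      exact ⟨p, hp, fun e p' he h => absurd h (hmeet e p' he)⟩
  obtain ⟨b, hb, hbw, hbo, hbj⟩ := hG.sep_label K hK j hj w p hpw
  obtain ⟨C, hC, hCo, hCg⟩ : ∃ C : V → Bool, (∀ h ∈ R', IsCompatible C h) ∧
      G.HasEnds b j (C ∘ o) ∧ ∀ y ∈ g.dom, C y = false := by
    rcases hbj with hbj | hbj
    · exact ⟨fun _ => false, fun _ _ => isCompatible_const _ _, hbj, fun _ _ => rfl⟩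
    · obtain ⟨C, hC, hCo, hCg⟩ := hT.sep_end R' hR' hk g hg p hpg
      exact ⟨C, hC, fun e he q => (hbj e he q).trans (hCo q).symm, hCg⟩
  obtain ⟨c, hc, hcb, hcJ, -⟩ := exists_extension hT hR' hk hR hb (J := {j}) hC
    (by rintro _ rfl; exact hCo) (o true)
  refine ⟨c, hc, (hcb w).trans hbw, fun q hq => (hcb _).trans (hbo q hq), ?_⟩
  rintro _ ⟨_, e, x, y, he, rfl, -, hxy⟩
  exact (hcJ e he x).trans (hCg x ⟨y, hxy⟩)

theorem exists_coloring_of_label_eq (hT : IsFrame k o T) (hG : G.Admissible (k + 1) oW)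
    (hR : R ⊆ spreadSet G o Set.univ T) (hk : R.encard ≤ k) (hl : G.label e = G.label e')
    (hne : e ≠ e' ∨ x ≠ z) (hz : z ∉ Set.range o) :
    ∃ c : Replacement W E o → Bool, (∀ h ∈ R, IsCompatible c h) ∧ c (embed G o e x) = true ∧
      c (embed G o e' z) = false := by
  obtain ⟨K, R', hj, hK, hR', hk', hRK⟩ := exists_subset_spreadSet hT hR hk (G.label e)
  by_cases hxz : x = z
  · obtain ⟨b, hb, hbe, hbe'⟩ := hG.sep_edge K hK e e' hj hl (hne.resolve_right (not_not.2 hxz))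
    obtain ⟨c, hc, -, -, hcne⟩ := exists_extension hT hR' hk' hRK hb (J := ∅)
      (fun _ _ => isCompatible_const true _) (fun _ h => absurd h (Set.notMem_empty _)) z
    refine ⟨c, hc, ?_, (hcne e' (Set.notMem_empty _)).2 hz true (hbe' true)⟩
    exact ((hcne e (Set.notMem_empty _)).1 (by rw [hbe, hbe]) x).trans (hbe true)
  · obtain ⟨C, hC, hCx, hCz⟩ := hT.sep R' hR' hk' (single z z)
      (hT.mem_of_isSlim _ (isSlim_single z z)) x (by simpa [dom_single] using hxz)
    obtain ⟨c, hc, hcj⟩ := exists_coloring_label hT hG hR' hk' hK hRK hj hC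
    exact ⟨c, hc, (hcj e rfl x).trans hCx, (hcj e' hl.symm z).trans (hCz z (by simp [dom_single]))⟩

theorem exists_coloring_of_ne [Nonempty L] (hT : IsFrame k o T) (hG : G.Admissible (k + 1) oW)
    (hR : R ⊆ spreadSet G o Set.univ T) (hk : R.encard ≤ k) (hXZ : X ≠ Z) :
    ∃ c : Replacement W E o → Bool, (∀ h ∈ R, IsCompatible c h) ∧ c X = true ∧ c Z = false := by
  obtain ⟨K, R', -, hK, hR', hk', hRK⟩ :=
    exists_subset_spreadSet hT hR hk (Classical.arbitrary L)
  rcases X with w | ⟨e, x, hx⟩ <;> rcases Z with w' | ⟨e', z, hz⟩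
  · obtain ⟨b, hb, hw, hw', -⟩ := hG.sep K hK w w' fun h => hXZ (h ▸ rfl)
    obtain ⟨c, hc, hcb, -⟩ := exists_extension hT hR' hk' hRK hb (J := ∅)
      (fun _ _ => isCompatible_const true _) (fun _ h => absurd h (Set.notMem_empty _)) (o true)
    exact ⟨c, hc, (hcb w).trans hw, (hcb w').trans hw'⟩
  · obtain ⟨c, hc, hcz, hcb, -⟩ := exists_coloring_inner hT hR' hk' hRK e' hz
    rw [embed_of_notMem hz] at hcz
    exact ⟨fun Y => !c Y, fun h hh => (hc h hh).comp (!·), by simp [hcb], by simp [hcz]⟩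
  · obtain ⟨c, hc, hcx, hcb, -⟩ := exists_coloring_inner hT hR' hk' hRK e hx
    exact ⟨c, hc, by rwa [embed_of_notMem hx] at hcx, hcb w'⟩
  rw [← embed_of_notMem (G := G), ← embed_of_notMem (G := G)]
  by_cases hl : G.label e = G.label e'
  · refine exists_coloring_of_label_eq hT hG hR hk hl ?_ hz
    by_contra! h
    obtain ⟨rfl, rfl⟩ := h
    exact hXZ rfl
  · obtain ⟨c, hc, hcx, -, hcne⟩ := exists_coloring_inner hT hR' hk' hRK e hx
    exact ⟨c, hc, hcx, hcne e' z (Ne.symm hl)⟩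

theorem exists_coloring_of_notMem_dom_spread (hT : IsFrame k o T) (hG : G.Admissible (k + 1) oW)
    (hR : R ⊆ spreadSet G o Set.univ T) (hk : R.encard ≤ k) (hg : g ∈ T)
    (hX : X ∉ (spread G o j g).dom) :
    ∃ c : Replacement W E o → Bool, (∀ h ∈ R, IsCompatible c h) ∧ c X = true ∧
      ∀ Y ∈ (spread G o j g).dom, c Y = false := by
  obtain ⟨K, R', hj, hK, hR', hk', hRK⟩ := exists_subset_spreadSet hT hR hk j
  rcases X with w | ⟨e, x, hx⟩
  · obtain ⟨c, hc, hcw, -, hcg⟩ := exists_coloring_base hT hG hR' hk' hK hRK hj hg hX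
    exact ⟨c, hc, hcw, hcg⟩
  rw [← embed_of_notMem (G := G)] at hX ⊢
  by_cases he : G.label e = j
  · rw [embed_mem_dom_spread hG hT.injective he] at hX
    obtain ⟨C, hC, hCx, hCg⟩ := hT.sep R' hR' hk' g hg x hX
    obtain ⟨c, hc, hcj⟩ := exists_coloring_label hT hG hR' hk' hK hRK hj hC
    refine ⟨c, hc, (hcj e he x).trans hCx, ?_⟩
    rintro _ ⟨_, e', y, z, he', rfl, -, hyz⟩
    exact (hcj e' he' y).trans (hCg y ⟨z, hyz⟩)
  · obtain ⟨c, hc, hcx, -, hcne⟩ := exists_coloring_inner hT hR' hk' hRK e hx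
    refine ⟨c, hc, hcx, ?_⟩
    rintro _ ⟨_, e', y, z, he', rfl, -, -⟩
    exact hcne e' y fun h => he (h.symm.trans he')

theorem exists_coloring_end_of_ne [Nonempty L] (hT : IsFrame k o T)
    (hG : G.Admissible (k + 1) oW) (hR : R ⊆ spreadSet G o Set.univ T) (hk : R.encard ≤ k)
    {q : Bool} (hZ : Z ≠ base (oW q)) :
    ∃ c : Replacement W E o → Bool, (∀ h ∈ R, IsCompatible c h) ∧ c (base (oW q)) = true ∧
      c (base (oW !q)) = false ∧ c Z = false := by
  obtain ⟨K, R', -, hK, hR', hk', hRK⟩ :=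
    exists_subset_spreadSet hT hR hk (Classical.arbitrary L)
  have hext (z : V) {b : W → Bool} (hb : ∀ j ∈ K, IsCompatible b (G.rel j)) :=
    exists_extension hT hR' hk' hRK hb (J := ∅) (fun _ _ => isCompatible_const true _)
      (fun _ h => absurd h (Set.notMem_empty _)) z
  rcases Z with w | ⟨e, z, hz⟩
  · obtain ⟨b, hb, hq, hw, hq'⟩ := hG.sep K hK (oW q) w fun h => hZ (h ▸ rfl)
    obtain ⟨c, hc, hcb, -⟩ := hext (o true) hb
    exact ⟨c, hc, (hcb _).trans hq, (hcb _).trans (hq' q rfl), (hcb w).trans hw⟩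
  · obtain ⟨p, hp⟩ : ∃ p, oW q ≠ G.vertex e p := by
      by_contra! h
      exact absurd (hG.matching rfl ((h false).symm.trans (h true))).2 (by simp)
    obtain ⟨b, hb, hq, hbp, hq'⟩ := hG.sep K hK (oW q) (G.vertex e p) hp
    obtain ⟨c, hc, hcb, -, hcne⟩ := hext z hb
    refine ⟨c, hc, (hcb _).trans hq, (hcb _).trans (hq' q rfl), ?_⟩
    rw [← embed_of_notMem (G := G)]
    exact (hcne e (Set.notMem_empty _)).2 hz p hbp

theorem exists_coloring_of_notMem_dom [Nonempty L] (hT : IsFrame k o T)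
    (hG : G.Admissible (k + 1) oW) (hR : R ⊆ spreadSet G o Set.univ T) (hk : R.encard ≤ k)
    {h : BinRel (Replacement W E o)} (hh : h ∈ spreadSet G o Set.univ T) (hX : X ∉ h.dom) :
    ∃ c : Replacement W E o → Bool, (∀ h ∈ R, IsCompatible c h) ∧ c X = true ∧
      ∀ Y ∈ h.dom, c Y = false := by
  rcases hh with hs | ⟨j, -, g, hg, rfl⟩
  · rcases hs.dom_subsingleton.eq_empty_or_singleton with hd | ⟨Z, hd⟩
    · exact ⟨fun _ => true, fun _ _ => isCompatible_const _ _, rfl, by simp [hd]⟩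
    · rw [hd] at hX ⊢
      obtain ⟨c, hc, hcX, hcZ⟩ := exists_coloring_of_ne hT hG hR hk hX
      exact ⟨c, hc, hcX, by rintro _ rfl; exact hcZ⟩
  · exact exists_coloring_of_notMem_dom_spread hT hG hR hk hg hX

theorem exists_coloring_of_notMem_range [Nonempty L] (hT : IsFrame k o T)
    (hG : G.Admissible (k + 1) oW) (hR : R ⊆ spreadSet G o Set.univ T) (hk : R.encard ≤ k)
    (hX : X ∉ Set.range (base ∘ oW)) :
    ∃ c : Replacement W E o → Bool, (∀ h ∈ R, IsCompatible c h) ∧ c X = true ∧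
      ∀ q, c (base (oW q)) = false := by
  obtain ⟨K, R', -, hK, hR', hk', hRK⟩ :=
    exists_subset_spreadSet hT hR hk (Classical.arbitrary L)
  rcases X with w | ⟨e, x, hx⟩
  · obtain ⟨b, hb, hbw, hbo⟩ := hG.sep_inner K hK w fun ⟨q, hq⟩ => hX ⟨q, congrArg base hq⟩
    obtain ⟨c, hc, hcb, -⟩ := exists_extension hT hR' hk' hRK hb (J := ∅)
      (fun _ _ => isCompatible_const true _) (fun _ h => absurd h (Set.notMem_empty _)) (o true)
    exact ⟨c, hc, (hcb w).trans hbw, fun q => (hcb _).trans (hbo q)⟩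
  · obtain ⟨c, hc, hcx, hcb, -⟩ := exists_coloring_inner hT hR' hk' hRK e hx
    exact ⟨c, hc, by rwa [embed_of_notMem hx] at hcx, fun q => hcb _⟩

theorem exists_coloring_end [Nonempty L] (hT : IsFrame k o T) (hG : G.Admissible (k + 1) oW)
    (hR : R ⊆ spreadSet G o Set.univ T) (hk : R.encard ≤ k) {h : BinRel (Replacement W E o)}
    (hh : h ∈ spreadSet G o Set.univ T) {q : Bool} (hq : base (oW q) ∉ h.dom) :
    ∃ c : Replacement W E o → Bool, (∀ h ∈ R, IsCompatible c h) ∧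
      (∀ q', c (base (oW q')) = (q' == q)) ∧ ∀ Y ∈ h.dom, c Y = false := by
  obtain ⟨c, hc, hcq, hcq', hcd⟩ : ∃ c : Replacement W E o → Bool, (∀ h ∈ R, IsCompatible c h) ∧
      c (base (oW q)) = true ∧ c (base (oW !q)) = false ∧ ∀ Y ∈ h.dom, c Y = false := by
    rcases hh with hs | ⟨j, -, g, hg, rfl⟩
    · obtain ⟨Z, hZ, hd⟩ : ∃ Z, Z ≠ base (oW q) ∧ h.dom ⊆ {Z} := by
        rcases hs.dom_subsingleton.eq_empty_or_singleton with hd | ⟨Z, hd⟩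
        · exact ⟨base (oW !q), by simp [hG.injective.eq_iff], by simp [hd]⟩
        · exact ⟨Z, by rw [hd] at hq; exact Ne.symm hq, hd.subset⟩
      obtain ⟨c, hc, hcq, hcq', hcZ⟩ := exists_coloring_end_of_ne hT hG hR hk hZ
      exact ⟨c, hc, hcq, hcq', fun Y hY => hd hY ▸ hcZ⟩
    · obtain ⟨K, R', hj, hK, hR', hk', hRK⟩ := exists_subset_spreadSet hT hR hk j
      obtain ⟨c, hc, hcq, hcq', hcg⟩ := exists_coloring_base hT hG hR' hk' hK hRK hj hg hq
      exact ⟨c, hc, hcq, hcq' q rfl, hcg⟩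
  refine ⟨c, hc, fun q' => ?_, hcd⟩
  rcases eq_or_ne q' q with rfl | hne
  · simpa using hcq
  · rw [Bool.eq_not_of_ne hne, hcq']
    simp

end Replacement

/-- One more label than `k` has to be in view: `k` relations involve at most `k` labels, and the
spare one is that of the relation from whose domain a point is to be separated. -/
theorem IsFrame.replace {W E L : Type*} [Nonempty L] {V : Type v} {k : ℕ} {o : Bool → V}
    {T : Set (BinRel V)} {G : LabeledDigraph W E L} {oW : Bool → W} (hT : IsFrame k o T)
    (hG : G.Admissible (k + 1) oW) :
    IsFrame k (Replacement.base ∘ oW) (Replacement.spreadSet G o Set.univ T) where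
  injective := fun _ _ h => hG.injective (Replacement.base.inj h)
  mem_of_isSlim _ hf := .inl hf
  mul_mem _ hf _ hg := Replacement.mul_mem_spreadSet hG hT hf hg
  star_mem _ hf := Replacement.star_mem_spreadSet hT hf
  rightUnique _ hf := Replacement.rightUnique_of_mem_spreadSet hG hT hf
  exists_notMem_dom _ hf := Replacement.exists_end_notMem_dom hG hT hf
  sep _ hR hk _ hf _ hX := Replacement.exists_coloring_of_notMem_dom hT hG hR hk hf hX
  sep_inner _ hR hk _ hX := Replacement.exists_coloring_of_notMem_range hT hG hR hk hX
  sep_end _ hR hk _ hf _ hq := Replacement.exists_coloring_end hT hG hR hk hf hq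

/-! ### The ladder -/

/-- The vertices `n = m₀, m₁, …, mₙ = 2n` of the second rail of the ladder. -/
def mirror (n i : ℕ) : ℤ := if i = 0 then n else if i = n then 2 * n else -i

/-- The edges of the ladder: `up j` leads from `j` to `j + 1` and `down j` from `mⱼ₊₁` to `mⱼ`. -/
inductive LadderEdge (n : ℕ) : Type
  | up (j : ℕ)
  | down (j : ℕ) (hj : j < n)

/-- The ladder has the ascending rail `0, 1, 2, …` and the descending rail `mₙ, …, m₁, m₀`, whose
ends lie on the ascending one. The pattern `x₁ ⋯ x₂ₙ (xₙ ⋯ x₁ · xₙ₊₁ ⋯ x₂ₙ) ^ (2m-1)` labels a walk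
from `0` to `2n`, with `xⱼ₊₁` on the edges labelled `j`. -/
def ladder (n : ℕ) : LabeledDigraph ℤ (LadderEdge n) ℕ where
  vertex
    | .up j, p => bif p then j + 1 else j
    | .down j _, p => mirror n (bif p then j else j + 1)
  label
    | .up j => j
    | .down j _ => j

/-- The ends `0` and `2n` of the ladder. -/
def ladderEnd (n : ℕ) (q : Bool) : ℤ := bif q then 2 * n else 0

section Ladder

variable {n l j : ℕ} {τ : ℕ → Bool} {w w' : ℤ}

/-- A colouring of the ladder in which every special vertex `0`, `n`, `n + 1`, …, `2n`, … is its own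
colour. Each pair `i`, `mᵢ = -i` with `0 < i < n` consists of one vertex of colour `n`, namely `i`
if `τ i` holds, and one of the colour `0` or `2n`, according as `i ≤ l` or not. -/
def ladderColor (n l : ℕ) (τ : ℕ → Bool) (w : ℤ) : ℤ :=
  if w ≤ -n ∨ w = 0 ∨ n ≤ w then w
  else if decide (0 < w) = τ w.natAbs then n
  else if w.natAbs ≤ l then 0 else 2 * n

/-- The vertex of colour `n` among `i` and `mᵢ` is `i`; extends `τ` to the values `0` and `n`. -/
def isUpper (n : ℕ) (τ : ℕ → Bool) (i : ℕ) : Bool := i == n || (i != 0 && τ i)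

theorem ladderColor_natCast {i : ℕ} (hl : l < n) (hi : i ≤ n) : ladderColor n l τ i =
    if isUpper n τ i then (n : ℤ) else if i ≤ l then 0 else 2 * n := by
  grind [ladderColor, isUpper]

theorem ladderColor_mirror {i : ℕ} (hl : l < n) (hi : i ≤ n) : ladderColor n l τ (mirror n i) =
    if isUpper n τ i then (if i ≤ l then 0 else 2 * n : ℤ) else n := by
  grind [ladderColor, isUpper, mirror]

theorem ladderColor_up (hl : l < n) (hj : j < n) (hjl : j ≠ l)
    (h : isUpper n τ j = isUpper n τ (j + 1)) (p : Bool) :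
    ladderColor n l τ ((ladder n).vertex (.up j) p) =
      if isUpper n τ j then (n : ℤ) else if j ≤ l then 0 else 2 * n := by
  cases p
  · exact ladderColor_natCast hl hj.le
  · refine (ladderColor_natCast (i := j + 1) hl hj).trans ?_
    simp only [h, show j + 1 ≤ l ↔ j ≤ l by omega]

theorem ladderColor_down (hl : l < n) (hj : j < n) (hjl : j ≠ l)
    (h : isUpper n τ j = isUpper n τ (j + 1)) (p : Bool) :
    ladderColor n l τ ((ladder n).vertex (.down j hj) p) =
      if isUpper n τ j then (if j ≤ l then 0 else 2 * n : ℤ) else n := by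
  cases p
  · refine (ladderColor_mirror (i := j + 1) hl hj).trans ?_
    simp only [h, show j + 1 ≤ l ↔ j ≤ l by omega]
  · exact ladderColor_mirror hl hj.le

theorem hasEnds_ladderColor (hl : l < n) (hj : j < n) (hjl : j ≠ l)
    (h : isUpper n τ j ≠ isUpper n τ (j + 1)) : (ladder n).HasEnds (ladderColor n l τ) j
      fun p => if p = isUpper n τ (j + 1) then (n : ℤ) else if j ≤ l then 0 else 2 * n := by
  have h₁ := ladderColor_natCast (τ := τ) hl hj.le
  have h₂ := ladderColor_natCast (τ := τ) (i := j + 1) hl hj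
  have h₃ := ladderColor_mirror (τ := τ) hl hj.le
  have h₄ := ladderColor_mirror (τ := τ) (i := j + 1) hl hj
  rintro (i | ⟨i, hi⟩) rfl p <;> cases p <;> grind [ladder]

theorem hasEnds_ladderColor_of_le (hj : n ≤ j) : (ladder n).HasEnds (ladderColor n l τ) j
    fun p => ladderColor n l τ ((ladder n).vertex (.up j) p) := by
  rintro (i | ⟨i, hi⟩) rfl p
  · rfl
  · exact absurd hi hj.not_gt

theorem isCompatible_ladderColor (hl : l < n) (hjl : j ≠ l) :
    IsCompatible (ladderColor n l τ) ((ladder n).rel j) := by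
  rw [LabeledDigraph.isCompatible_rel_iff]
  rcases lt_or_ge j n with hj | hj
  · by_cases h : isUpper n τ j = isUpper n τ (j + 1)
    · refine .inl ?_
      rintro (i | ⟨i, hi⟩) rfl p
      · exact (ladderColor_up hl hj hjl h p).trans (ladderColor_up hl hj hjl h true).symm
      · exact (ladderColor_down hl hj hjl h p).trans (ladderColor_down hl hj hjl h true).symm
    · exact .inr ⟨_, hasEnds_ladderColor hl hj hjl h⟩
  · exact .inr ⟨_, hasEnds_ladderColor_of_le hj⟩

theorem exists_ladderColor_ne (hl : l < n) (h : w ≠ w') :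
    ∃ τ, ladderColor n l τ w ≠ ladderColor n l τ w' := by
  by_contra! hcon
  have h₁ := hcon fun i => if i = w.natAbs then decide (0 < w) else !decide (0 < w')
  have h₂ := hcon fun i => if i = w'.natAbs then decide (0 < w') else !decide (0 < w)
  grind [ladderColor]

theorem exists_ladderColor_ne_ends (hl : l < n) (hw : w ∉ Set.range (ladderEnd n)) :
    ∃ τ, ∀ q, ladderColor n l τ (ladderEnd n q) ≠ ladderColor n l τ w := by
  refine ⟨fun _ => decide (0 < w), ?_⟩
  have h₁ : ladderEnd n false ≠ w := fun h => hw ⟨_, h⟩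
  have h₂ : ladderEnd n true ≠ w := fun h => hw ⟨_, h⟩
  rintro (_ | _) <;> grind [ladderColor, ladderEnd]

theorem exists_ladderColor_hasEnds (hl : l < n) (hjl : j ≠ l) {p : Bool}
    (hw : ∀ e p', (ladder n).label e = j → (ladder n).vertex e p' = w → p' = p) :
    ∃ τ γ, (ladder n).HasEnds (ladderColor n l τ) j γ ∧ γ (!p) ≠ ladderColor n l τ w := by
  have hup : (ladder n).vertex (.up j) (!p) ≠ w := fun h => by simpa using hw (.up j) (!p) rfl h
  rcases le_or_gt n j with hj | hj
  · obtain ⟨τ, hτ⟩ := exists_ladderColor_ne hl hup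
    exact ⟨τ, _, hasEnds_ladderColor_of_le hj, hτ⟩
  have hdown : (ladder n).vertex (.down j hj) (!p) ≠ w :=
    fun h => by simpa using hw (.down j hj) (!p) rfl h
  suffices ∃ τ, isUpper n τ j ≠ isUpper n τ (j + 1) ∧
      (if (!p) = isUpper n τ (j + 1) then (n : ℤ) else if j ≤ l then 0 else 2 * n) ≠
        ladderColor n l τ w by
    obtain ⟨τ, h, hτ⟩ := this
    exact ⟨τ, _, hasEnds_ladderColor hl hj hjl h, hτ⟩
  by_cases hs : w ≤ -n ∨ w = 0 ∨ n ≤ w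
  · refine ⟨fun i => if j = 0 then true else if j + 1 = n then false else
      (i == j) == (decide (w = n) == !p), ?_⟩
    cases p <;> grind [ladderColor, isUpper, ladder, mirror]
  · refine ⟨fun i => if i = j then false else if i = j + 1 then true else decide (0 < w) == p, ?_⟩
    cases p <;> grind [ladderColor, isUpper, ladder, mirror]

theorem ladderColor_edge (hl : l < n) (hj : j < n) (hjl : j ≠ l) :
    ∃ τ c c', c ≠ c' ∧ (∀ p, ladderColor n l τ ((ladder n).vertex (.up j) p) = c) ∧
      ∀ p, ladderColor n l τ ((ladder n).vertex (.down j hj) p) = c' := by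
  have h : isUpper n (fun _ => decide (j ≠ 0)) j = isUpper n (fun _ => decide (j ≠ 0)) (j + 1) := by
    grind [isUpper]
  refine ⟨fun _ => decide (j ≠ 0), _, _, ?_, ladderColor_up hl hj hjl h,
    ladderColor_down hl hj hjl h⟩
  grind

theorem ladderColor_ladderEnd (q : Bool) :
    ladderColor n l τ (ladderEnd n q) = ladderEnd n q := by
  cases q <;> grind [ladderColor, ladderEnd]

theorem exists_notMem_of_encard_lt {K : Set ℕ} (hK : K.encard < n) : ∃ l < n, l ∉ K := by
  by_contra! h
  refine hK.not_ge ?_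
  calc (n : ℕ∞) = (Finset.range n : Set ℕ).encard := by
        rw [Set.encard_coe_eq_coe_finsetCard, Finset.card_range]
    _ ≤ K.encard := Set.encard_le_encard fun l hl => h l (by simpa using hl)

/-- The two-colouring of the ladder that singles out one colour of `ladderColor`. -/
def ladderBool (n l : ℕ) (τ : ℕ → Bool) (c w : ℤ) : Bool := decide (ladderColor n l τ w = c)

theorem isCompatible_ladderBool (hl : l < n) {K : Set ℕ} (hK : l ∉ K) (c : ℤ) :
    ∀ j ∈ K, IsCompatible (ladderBool n l τ c) ((ladder n).rel j) :=
  fun _ hj =>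
    (isCompatible_ladderColor hl (ne_of_mem_of_not_mem hj hK)).comp fun a => decide (a = c)

theorem ladderBool_ladderEnd_not (hn : n ≠ 0) (q : Bool) (hw : w = ladderEnd n q) :
    ladderBool n l τ (ladderColor n l τ w) (ladderEnd n !q) = false := by
  rw [hw, ladderBool, ladderColor_ladderEnd, ladderColor_ladderEnd]
  cases q <;> simp [ladderEnd, hn]

theorem exists_ladderBool_edge (hl : l < n) {K : Set ℕ} (hlK : l ∉ K) {e e' : LadderEdge n}
    (he : (ladder n).label e ∈ K) (hee' : (ladder n).label e = (ladder n).label e')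
    (hne : e ≠ e') : ∃ τ c, (∀ p, ladderBool n l τ c ((ladder n).vertex e p) = true) ∧
      ∀ p, ladderBool n l τ c ((ladder n).vertex e' p) = false := by
  obtain ⟨j, hj, hj'⟩ : ∃ j, ∃ hj : j < n,
      (e = .up j ∧ e' = .down j hj) ∨ (e = .down j hj ∧ e' = .up j) := by
    rcases e with i | ⟨i, hi⟩ <;> rcases e' with i' | ⟨i', hi'⟩ <;> grind [ladder]
  have hjl : j ≠ l := by
    rcases hj' with ⟨rfl, rfl⟩ | ⟨rfl, rfl⟩ <;> exact ne_of_mem_of_not_mem he hlK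
  obtain ⟨τ, c, c', hc, hup, hdown⟩ := ladderColor_edge hl hj hjl
  rcases hj' with ⟨rfl, rfl⟩ | ⟨rfl, rfl⟩
  · exact ⟨τ, c, fun p => decide_eq_true (hup p),
      fun p => decide_eq_false (hdown p ▸ hc.symm)⟩
  · exact ⟨τ, c',
      fun p => decide_eq_true (hdown p), fun p => decide_eq_false (hup p ▸ hc)⟩

theorem hasEnds_ladderBool {γ : Bool → ℤ} {c : ℤ} {p : Bool}
    (hγ : (ladder n).HasEnds (ladderColor n l τ) j γ) (hc : γ (!p) ≠ c) :
    (ladder n).HasEnds (ladderBool n l τ c) j (fun _ => false) ∨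
      (ladder n).HasEnds (ladderBool n l τ c) j (· == p) := by
  by_cases h : γ p = c
  · refine .inr fun e he q => ?_
    rw [ladderBool, hγ e he q]
    cases p <;> cases q <;> simp_all
  · refine .inl fun e he q => ?_
    rw [ladderBool, hγ e he q]
    cases p <;> cases q <;> simp_all

theorem admissible_ladder {k : ℕ} (hn : 2 ≤ n) (hk : k < n) :
    (ladder n).Admissible k (ladderEnd n) where
  injective := by rintro (_ | _) (_ | _) <;> grind [ladderEnd]
  matching := by
    rintro (i | ⟨i, hi⟩) (i' | ⟨i', hi'⟩) (_ | _) (_ | _) <;> grind [ladder, mirror]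
  meet := by
    rintro (i | ⟨i, hi⟩) (i' | ⟨i', hi'⟩) (j | ⟨j, hj⟩) (j' | ⟨j', hj'⟩) (_ | _) (_ | _) <;>
      grind [ladder, mirror]
  ends := by
    rintro (i | ⟨i, hi⟩) (i' | ⟨i', hi'⟩) (_ | _) <;> grind [ladder, mirror, ladderEnd]
  sep K hK w w' hw := by
    obtain ⟨l, hl, hlK⟩ := exists_notMem_of_encard_lt (hK.trans_lt (mod_cast hk))
    obtain ⟨τ, hτ⟩ := exists_ladderColor_ne hl hw
    exact ⟨ladderBool n l τ (ladderColor n l τ w), isCompatible_ladderBool hl hlK _,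
      decide_eq_true rfl, decide_eq_false hτ.symm, ladderBool_ladderEnd_not (by omega)⟩
  sep_inner K hK w hw := by
    obtain ⟨l, hl, hlK⟩ := exists_notMem_of_encard_lt (hK.trans_lt (mod_cast hk))
    obtain ⟨τ, hτ⟩ := exists_ladderColor_ne_ends hl hw
    exact ⟨ladderBool n l τ (ladderColor n l τ w), isCompatible_ladderBool hl hlK _,
      decide_eq_true rfl, fun q => decide_eq_false (hτ q)⟩
  sep_edge K hK e e' he hee' hne := by
    obtain ⟨l, hl, hlK⟩ := exists_notMem_of_encard_lt (hK.trans_lt (mod_cast hk))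
    obtain ⟨τ, c, he, he'⟩ := exists_ladderBool_edge hl hlK he hee' hne
    exact ⟨ladderBool n l τ c, isCompatible_ladderBool hl hlK _, he, he'⟩
  sep_label K hK j hj w p hp := by
    obtain ⟨l, hl, hlK⟩ := exists_notMem_of_encard_lt (hK.trans_lt (mod_cast hk))
    obtain ⟨τ, γ, hγ, hne⟩ := exists_ladderColor_hasEnds hl (ne_of_mem_of_not_mem hj hlK) hp
    exact ⟨ladderBool n l τ (ladderColor n l τ w), isCompatible_ladderBool hl hlK _,
      decide_eq_true rfl, ladderBool_ladderEnd_not (by omega), hasEnds_ladderBool hγ hne⟩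

end Ladder

/-! ### Identities of the Brandt monoid -/

/-- The largest index of a variable of a term. -/
def Term.maxVar : Term → ℕ
  | .var i => i
  | .mul p q => max p.maxVar q.maxVar
  | .star p => p.maxVar

theorem Term.eval_congr {A : Type u} [Mul A] [Star A] {θ θ' : ℕ → A} (p : Term)
    (h : ∀ i ≤ p.maxVar, θ i = θ' i) : p.eval θ = p.eval θ' := by
  induction p with
  | var i => exact h i le_rfl
  | mul p q hp hq =>
    exact congrArg₂ (· * ·) (hp fun i hi => h i (le_max_of_le_left hi))
      (hq fun i hi => h i (le_max_of_le_right hi))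
  | star p hp => exact congrArg Star.star (hp h)

theorem Term.map_eval {A : Type u} [Mul A] [Star A] {A' : Type v} [Mul A'] [Star A'] (ψ : A → A')
    (hmul : ∀ a b, ψ (a * b) = ψ a * ψ b) (hstar : ∀ a, ψ (Star.star a) = Star.star (ψ a))
    (θ : ℕ → A) (p : Term) : ψ (p.eval θ) = p.eval fun i => ψ (θ i) := by
  induction p with
  | var i => rfl
  | mul p q hp hq => simp only [Term.eval, hmul, hp, hq]
  | star p hp => simp only [Term.eval, hstar, hp]

/-- The nonzero entries of a matrix in the Brandt monoid, with rows and columns named by the two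
colours. -/
def brandtRel (M : Brandt) : BinRel Bool :=
  fun a b => M.1 (finTwoEquiv.symm a) (finTwoEquiv.symm b) ≠ 0

theorem brandtSet_nonneg {M : Matrix (Fin 2) (Fin 2) ℤ} (hM : M ∈ brandtSet) (i j : Fin 2) :
    0 ≤ M i j := by
  simp only [brandtSet, Set.mem_insert_iff, Set.mem_singleton_iff] at hM
  rcases hM with rfl | rfl | rfl | rfl | rfl | rfl <;> fin_cases i <;> fin_cases j <;> simp

theorem brandtRel_mul (M N : Brandt) : brandtRel (M * N) = brandtRel M * brandtRel N := by
  ext a b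
  change (M.1 * N.1) _ _ ≠ 0 ↔ ∃ c, M.1 _ (finTwoEquiv.symm c) ≠ 0 ∧ N.1 (finTwoEquiv.symm c) _ ≠ 0
  rw [Matrix.mul_apply, ne_eq, Finset.sum_eq_zero_iff_of_nonneg fun l _ =>
    mul_nonneg (brandtSet_nonneg M.2 _ l) (brandtSet_nonneg N.2 l _),
    finTwoEquiv.symm.exists_congr_left]
  simp only [Finset.mem_univ, mul_eq_zero, true_imp_iff, not_forall, not_or]
  simp

theorem brandtRel_star (M : Brandt) : brandtRel (Star.star M) = Star.star (brandtRel M) := rfl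

theorem rightUnique_brandtRel (M : Brandt) : Relator.RightUnique (brandtRel M) := by
  obtain ⟨M, hM⟩ := M
  have hM' : M ∈ brandtSet := hM
  simp only [brandtSet, Set.mem_insert_iff, Set.mem_singleton_iff] at hM'
  unfold Relator.RightUnique brandtRel
  rcases hM' with rfl | rfl | rfl | rfl | rfl | rfl <;> simp [finTwoEquiv]

theorem exists_brandtRel_eq {P : BinRel Bool} (hP : IsCompatible id P) : ∃ M, brandtRel M = P := by
  classical
  refine ⟨⟨!![if P false false then 1 else 0, if P false true then 1 else 0;
    if P true false then 1 else 0, if P true true then 1 else 0], ?_⟩, ?_⟩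
  · change _ ∈ brandtSet
    by_cases h₁ : P false false <;> by_cases h₂ : P false true <;> by_cases h₃ : P true false <;>
      by_cases h₄ : P true true <;> simp only [h₁, h₂, h₃, h₄, brandtSet] <;> grind [IsCompatible]
  · ext a b
    cases a <;> cases b <;> simp [brandtRel, finTwoEquiv]

section Transfer

variable {V : Type v} {k : ℕ} {o : Bool → V} {T : Set (BinRel V)} {F : ℕ → BinRel V}
  {c : V → Bool} {p q : Term} {x y : V}

theorem eval_map_of_eval (c : V → Bool) (p : Term) :
    ∀ {x y}, p.eval F x y → p.eval (fun i => (F i).map c) (c x) (c y) := by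
  induction p with
  | var i => exact fun h => ⟨_, _, h, rfl, rfl⟩
  | mul p q hp hq => exact fun ⟨y, hxy, hyz⟩ => ⟨c y, hp hxy, hq hyz⟩
  | star p hp => exact fun h => hp h

theorem exists_eval_map_eq_brandtRel (hc : ∀ i, IsCompatible c (F i)) :
    ∃ M : ℕ → Brandt, ∀ p : Term, p.eval (fun i => (F i).map c) = brandtRel (p.eval M) := by
  choose M hM using fun i => exists_brandtRel_eq (hc i).map
  refine ⟨M, fun p => ?_⟩
  simp only [Term.map_eval brandtRel brandtRel_mul brandtRel_star, hM]

theorem rightUnique_eval_map (hc : ∀ i, IsCompatible c (F i)) (p : Term) :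
    Relator.RightUnique (p.eval fun i => (F i).map c : BinRel Bool) := by
  obtain ⟨M, hM⟩ := exists_eval_map_eq_brandtRel hc
  exact hM p ▸ rightUnique_brandtRel _

theorem eval_map_eq_eval_map (hc : ∀ i, IsCompatible c (F i)) (h : Satisfies Brandt ⟨p, q⟩) :
    p.eval (fun i => (F i).map c) = q.eval fun i => (F i).map c := by
  obtain ⟨M, hM⟩ := exists_eval_map_eq_brandtRel hc
  exact (hM p).trans ((congrArg brandtRel (h M)).trans (hM q).symm)

namespace IsFrame

theorem mem_dom_of_forall_isCompatible (hT : IsFrame k o T) (hF : Set.range F ⊆ T)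
    (hk : (Set.range F).encard ≤ k) {f : BinRel V} (hf : f ∈ T)
    (h : ∀ c : V → Bool, (∀ i, IsCompatible c (F i)) → c x ∈ (f.map c).dom) : x ∈ f.dom := by
  by_contra hx
  obtain ⟨c, hc, hcx, hcf⟩ := hT.sep _ hF hk f hf x hx
  obtain ⟨_, x', y', hxy', hx', -⟩ := h c fun i => hc _ ⟨i, rfl⟩
  simp [hcx, hcf x' ⟨y', hxy'⟩] at hx'

/-- Ranges are treated alongside domains because the induction passes through the operation `*`,
which exchanges them. -/
theorem mem_dom_eval_of_forall (hT : IsFrame k o T) (hF : Set.range F ⊆ T)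
    (hk : (Set.range F).encard ≤ k) (p : Term) :
    (∀ x, (∀ c : V → Bool, (∀ i, IsCompatible c (F i)) →
      c x ∈ (p.eval fun i => (F i).map c).dom) → x ∈ (p.eval F).dom) ∧
    ∀ y, (∀ c : V → Bool, (∀ i, IsCompatible c (F i)) →
      c y ∈ (Star.star (p.eval fun i => (F i).map c)).dom) → y ∈ (Star.star (p.eval F)).dom := by
  induction p with
  | var i =>
    refine ⟨fun x hx => hT.mem_dom_of_forall_isCompatible hF hk (hF ⟨i, rfl⟩) hx, fun y hy => ?_⟩
    refine hT.mem_dom_of_forall_isCompatible hF hk (hT.star_mem _ (hF ⟨i, rfl⟩)) fun c hc => ?_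
    exact map_star c (F i) ▸ hy c hc
  | mul p q hp hq =>
    refine ⟨fun x hx => ?_, fun z hz => ?_⟩
    · obtain ⟨y, hxy⟩ := hp.1 x fun c hc => by
        obtain ⟨_, b, hb, -⟩ := hx c hc
        exact ⟨b, hb⟩
      obtain ⟨z, hyz⟩ := hq.1 y fun c hc => by
        obtain ⟨a, b, hb, hba⟩ := hx c hc
        obtain rfl : b = c y := rightUnique_eval_map hc p hb (eval_map_of_eval c p hxy)
        exact ⟨a, hba⟩
      exact ⟨z, y, hxy, hyz⟩
    · obtain ⟨y, hyz⟩ := hq.2 z fun c hc => by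
        obtain ⟨_, b, -, hb⟩ := hz c hc
        exact ⟨b, hb⟩
      obtain ⟨x, hxy⟩ := hp.2 y fun c hc => by
        obtain ⟨a, b, hab, hb⟩ := hz c hc
        obtain rfl : b = c y := rightUnique_eval_map hc q.star hb (eval_map_of_eval c q hyz)
        exact ⟨a, hab⟩
      exact ⟨x, y, hxy, hyz⟩
  | star p hp => exact hp.symm

theorem eval_of_eval (hT : IsFrame k o T) (hF : Set.range F ⊆ T)
    (hk : (Set.range F).encard ≤ k) (h : Satisfies Brandt ⟨p, q⟩) (hxy : p.eval F x y) :
    q.eval F x y := by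
  have hq {c : V → Bool} (hc : ∀ i, IsCompatible c (F i)) :
      q.eval (fun i => (F i).map c) (c x) (c y) :=
    eval_map_eq_eval_map hc h ▸ eval_map_of_eval c p hxy
  obtain ⟨z, hxz⟩ := (hT.mem_dom_eval_of_forall hF hk q).1 x fun c hc => ⟨_, hq hc⟩
  obtain rfl : y = z := by
    by_contra hyz
    obtain ⟨c, hc, hcy, hcz⟩ := hT.sep _ hF hk (single z z)
      (hT.mem_of_isSlim _ (isSlim_single z z)) y (by simpa [dom_single] using hyz)
    have hc' (i) : IsCompatible c (F i) := hc _ ⟨i, rfl⟩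
    have hcyz : c y = c z := rightUnique_eval_map hc' q (hq hc') (eval_map_of_eval c q hxz)
    simp [hcy, hcz z (by simp [dom_single])] at hcyz
  exact hxz

/-- The members of a frame as an algebra of type `(2,1)`. -/
def Algebra (_ : IsFrame k o T) : Type v := T

instance (hT : IsFrame k o T) : Mul hT.Algebra := ⟨fun f g => ⟨f.1 * g.1, hT.mul_mem _ f.2 _ g.2⟩⟩

instance (hT : IsFrame k o T) : Star hT.Algebra := ⟨fun f => ⟨Star.star f.1, hT.star_mem _ f.2⟩⟩

theorem val_eval (hT : IsFrame k o T) (θ : ℕ → hT.Algebra) (p : Term) :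
    (p.eval θ).1 = p.eval fun i => (θ i).1 :=
  Term.map_eval (fun f : hT.Algebra => (f.1 : BinRel V)) (fun _ _ => rfl) (fun _ => rfl) θ p

theorem satisfies_algebra (hT : IsFrame k o T) {e : Identity} (he : Satisfies Brandt e)
    (hl : e.lhs.maxVar < k) (hr : e.rhs.maxVar < k) : Satisfies hT.Algebra e := by
  intro θ
  let F (i : ℕ) : BinRel V := (θ (min i (k - 1))).1
  have hF : Set.range F ⊆ T := Set.range_subset_iff.2 fun i => (θ _).2
  have hk : (Set.range F).encard ≤ k := by
    calc (Set.range F).encard ≤ ((fun i => (θ i).1) '' (Finset.range k : Set ℕ)).encard := by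
          refine Set.encard_le_encard (Set.range_subset_iff.2 fun i => ⟨min i (k - 1), ?_, rfl⟩)
          simp only [Finset.coe_range, Set.mem_Iio]
          omega
      _ ≤ (Finset.range k : Set ℕ).encard := Set.encard_image_le _ _
      _ = k := by rw [Set.encard_coe_eq_coe_finsetCard, Finset.card_range]
  have heval {p : Term} (hp : p.maxVar < k) : (p.eval θ).1 = p.eval F := by
    rw [hT.val_eval]
    exact p.eval_congr fun i hi => by simp only [F, min_eq_left (show i ≤ k - 1 by omega)]
  apply Subtype.ext
  rw [heval hl, heval hr]
  ext x y
  exact ⟨hT.eval_of_eval hF hk he, hT.eval_of_eval hF hk fun θ => (he θ).symm⟩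

end IsFrame

end Transfer

/-! ### The words `v_{n,m}^{(h)}` -/

theorem map_vPattern {M : Type u} {N : Type v} [Monoid M] [Monoid N] (ψ : M →* N) (n m : ℕ)
    (f : ℕ → M) : ψ (vPattern n m f) = vPattern n m fun j => ψ (f j) := by
  simp [vPattern, map_list_prod, List.map_map, Function.comp_def]

section Path

variable {X : Type v} {f : ℕ → BinRel X} {P : ℕ → X}

theorem prod_range'_apply (a len : ℕ)
    (h : ∀ i, a ≤ i → i < a + len → f (i + 1) (P i) (P (i + 1))) :
    ((List.range' (a + 1) len).map f).prod (P a) (P (a + len)) := by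
  induction len generalizing a with
  | zero => exact rfl
  | succ len ih =>
    rw [List.range'_succ, List.map_cons, List.prod_cons]
    refine ⟨_, h a le_rfl (by omega), ?_⟩
    have htail := ih (a + 1) fun i hi hi' => h i (by omega) (by omega)
    rwa [show a + 1 + len = a + (len + 1) by omega] at htail

theorem prod_reverse_range'_apply (a len : ℕ)
    (h : ∀ i, a ≤ i → i < a + len → f (i + 1) (P (i + 1)) (P i)) :
    ((List.range' (a + 1) len).reverse.map f).prod (P (a + len)) (P a) := by
  induction len generalizing a with
  | zero => exact rfl
  | succ len ih =>
    rw [List.range'_succ, List.reverse_cons, List.map_append, List.prod_append]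
    have htail := ih (a + 1) fun i hi hi' => h i (by omega) (by omega)
    rw [show a + 1 + len = a + (len + 1) by omega] at htail
    exact ⟨_, htail, by simpa using h a le_rfl (by omega)⟩

theorem vPattern_apply_of_ladder {n : ℕ} (hn : n ≠ 0) (m : ℕ) {P : ℤ → X}
    (h : ∀ e, f ((ladder n).label e + 1) (P ((ladder n).vertex e false))
      (P ((ladder n).vertex e true))) :
    vPattern n m f (P (ladderEnd n false)) (P (ladderEnd n true)) := by
  have up (i : ℕ) : f (i + 1) (P i) (P ((i + 1 : ℕ) : ℤ)) := by
    simpa [ladder] using h (.up i)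
  have down (i : ℕ) (hi : i < n) : f (i + 1) (P (mirror n (i + 1))) (P (mirror n i)) := by
    simpa [ladder] using h (.down i hi)
  have first : ((List.range' 1 (2 * n)).map f).prod (P 0) (P (2 * n)) := by
    simpa using prod_range'_apply (P := fun i : ℕ => P i) 0 (2 * n) fun i _ _ => up i
  have second : ((List.range' 1 n).reverse.map f).prod (P (2 * n)) (P n) := by
    simpa [mirror, hn] using prod_reverse_range'_apply (P := fun i => P (mirror n i)) 0 n
      fun i _ hi => down i (by omega)
  have third : ((List.range' (n + 1) n).map f).prod (P n) (P (2 * n)) := by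
    simpa [two_mul] using prod_range'_apply (P := fun i : ℕ => P i) n n fun i _ _ => up i
  exact ⟨_, first, pow_apply_self ⟨_, second, third⟩ _⟩

end Path

theorem lift_spread_apply {W E L : Type*} {G : LabeledDigraph W E L} {V : Type v} {o : Bool → V}
    {φ : List ℕ → BinRel V} (e : E) (w : Word) : ∀ {x y}, FreeMonoid.lift φ w x y →
      FreeMonoid.lift (fun I => Replacement.spread G o (G.label e) (φ I)) w
        (Replacement.embed G o e x) (Replacement.embed G o e y) := by
  induction w using FreeMonoid.inductionOn' with
  | one =>
    rintro x _ rfl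
    exact rfl
  | of_mul I w ih =>
    intro x y h
    rw [map_mul, FreeMonoid.lift_eval_of] at h ⊢
    obtain ⟨z, hxz, hzy⟩ := h
    exact ⟨_, ⟨e, x, z, rfl, rfl, rfl, hxz⟩, ih hzy⟩

theorem exists_isFrame_vWord_apply {n k : ℕ} (hn : 2 ≤ n) (hk : k + 1 < n) (m h : ℕ) :
    ∃ (V : Type v) (o : Bool → V) (T : Set (BinRel V)) (φ : List ℕ → BinRel V),
      IsFrame k o T ∧ (∀ I, φ I ∈ T) ∧
        FreeMonoid.lift φ (vWord n m h) (o false) (o true) := by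
  induction h with
  | zero =>
    exact ⟨ULift Bool, _, _, fun _ => single ⟨false⟩ ⟨true⟩, isFrame_isSlim k,
      fun _ => isSlim_single _ _, rfl, rfl⟩
  | succ h ih =>
    obtain ⟨V, o, T, φ, hT, hφ, hw⟩ := ih
    -- The last index of a variable selects the label, and the others the relation on the copies.
    let φ' (I : List ℕ) := Replacement.spread (ladder n) o (I.getLast?.getD 0 - 1) (φ I.dropLast)
    refine ⟨_, _, _, φ', hT.replace (admissible_ladder hn hk),
      fun I => .inr ⟨_, Set.mem_univ _, _, hφ _, rfl⟩, ?_⟩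
    rw [vWord, map_vPattern]
    refine vPattern_apply_of_ladder (by omega) m fun e => ?_
    have happend : (FreeMonoid.lift φ').comp (appendIndex ((ladder n).label e + 1)) =
        FreeMonoid.lift fun I => Replacement.spread (ladder n) o ((ladder n).label e) (φ I) :=
      FreeMonoid.hom_eq fun I => by simp [appendIndex, φ']
    have hcopy := lift_spread_apply (G := ladder n) (o := o) e _ hw
    rw [← happend, Replacement.embed_end hT.injective, Replacement.embed_end hT.injective] at hcopy
    exact hcopy

/-- A nonempty word as a term; the empty word gets a junk value. -/
def wordTerm (w : Word) : Term :=
  match w.toList with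
  | [] => .var 0
  | I :: l => l.foldl (fun t J => .mul t (.var (Encodable.encode J))) (.var (Encodable.encode I))

theorem map_eval_wordTerm {A : Type u} [Mul A] [Star A] {N : Type v} [Monoid N] (ψ : A → N)
    (hψ : ∀ a b, ψ (a * b) = ψ a * ψ b) (θ : ℕ → A) {w : Word} (hw : w ≠ 1) :
    ψ ((wordTerm w).eval θ) = FreeMonoid.lift (fun I => ψ (θ (Encodable.encode I))) w := by
  have hfoldl (l : List (List ℕ)) (t : Term) :
      ψ ((l.foldl (fun t J => Term.mul t (.var (Encodable.encode J))) t).eval θ) =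
        ψ (t.eval θ) * (l.map fun I => ψ (θ (Encodable.encode I))).prod := by
    induction l generalizing t with
    | nil => simp
    | cons J l ih => simp [ih, Term.eval, hψ, mul_assoc]
  cases w using FreeMonoid.casesOn with
  | one => exact absurd rfl hw
  | of_mul I w => simp [wordTerm, hfoldl, Term.eval, FreeMonoid.lift_apply]

theorem sq_ne_one {w : Word} (hw : w ≠ 1) : w ^ 2 ≠ 1 := by
  rw [ne_eq, ← FreeMonoid.length_eq_zero] at hw ⊢
  rw [pow_two, FreeMonoid.length_mul]
  omega

/-- The identity of type `(2,1)` that corresponds to the identity `w = w²` of words. -/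
def idempotentIdentity (w : Word) : Identity := ⟨wordTerm w, wordTerm (w ^ 2)⟩

theorem satisfies_idempotentIdentity {S : Type u} [Semigroup S] [Star S] {w : Word}
    (h : SatisfiesWords S w (w ^ 2)) : Satisfies S (idempotentIdentity w) := by
  intro θ
  rcases eq_or_ne w 1 with rfl | hw
  · simp only [idempotentIdentity, one_pow]
  apply WithOne.coe_injective
  have hcoe {w : Word} (hw : w ≠ 1) := map_eval_wordTerm ((↑) : S → WithOne S) WithOne.coe_mul θ hw
  exact (hcoe hw).trans ((h _).trans (hcoe (sq_ne_one hw)).symm)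

theorem IsFrame.not_satisfies_idempotentIdentity {V : Type v} {k : ℕ} {o : Bool → V}
    {T : Set (BinRel V)} (hT : IsFrame k o T) {φ : List ℕ → BinRel V} (hφ : ∀ I, φ I ∈ T)
    {w : Word} (hφw : FreeMonoid.lift φ w (o false) (o true)) :
    ¬ Satisfies hT.Algebra (idempotentIdentity w) := by
  intro h
  have hw : w ≠ 1 := by
    rintro rfl
    exact Bool.false_ne_true (hT.injective hφw)
  let θ (i : ℕ) : hT.Algebra := ⟨φ ((Encodable.decode i).getD []), hφ _⟩
  have heval {w : Word} (hw : w ≠ 1) : ((wordTerm w).eval θ).1 = FreeMonoid.lift φ w := by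
    simpa [θ] using map_eval_wordTerm (fun f : hT.Algebra => (f.1 : BinRel V))
      (fun _ _ => rfl) θ hw
  have hmem : FreeMonoid.lift φ w ∈ T := heval hw ▸ ((wordTerm w).eval θ).2
  have hsq : FreeMonoid.lift φ w = FreeMonoid.lift φ w * FreeMonoid.lift φ w := by
    rw [← pow_two, ← map_pow, ← heval hw, ← heval (sq_ne_one hw)]
    exact congrArg Subtype.val (h θ)
  obtain ⟨y, hy, hyo⟩ := hsq ▸ hφw
  obtain rfl := hT.rightUnique _ hmem hy hφw
  exact Bool.false_ne_true (hT.eq_of_mem_dom hmem ⟨_, hφw⟩ ⟨_, hyo⟩)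

end InvSemigroup

theorem mainTheorem6_general (S : Type u) [Semigroup S] [Star S]
    (hv : ∃ᶠ n in Filter.atTop, ∃ m ≥ 1, ∃ h,
      InvSemigroup.SatisfiesWords S (InvSemigroup.vWord n m h) (InvSemigroup.vWord n m h ^ 2))
    (hB : ∀ e : InvSemigroup.Identity,
      InvSemigroup.Satisfies S e → InvSemigroup.Satisfies InvSemigroup.Brandt e) :
    ¬ InvSemigroup.HasFiniteIdentityBasis.{u, v} S := by
  rintro ⟨B, hfin, hBS, hbasis⟩
  obtain ⟨k, hk⟩ := (hfin.image fun e => max e.lhs.maxVar e.rhs.maxVar).bddAbove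
  obtain ⟨n, ⟨m, -, h, hS⟩, hn⟩ := (hv.and_eventually (Filter.eventually_ge_atTop (k + 3))).exists
  obtain ⟨V, o, T, φ, hT, hφ, hw⟩ := InvSemigroup.exists_isFrame_vWord_apply.{v}
    (k := k + 1) (show 2 ≤ n by omega) (by omega) m h
  have hBT : ∀ e ∈ B, InvSemigroup.Satisfies hT.Algebra e := fun e he => by
    obtain ⟨hl, hr⟩ := max_le_iff.1 (hk ⟨e, he, rfl⟩)
    exact hT.satisfies_algebra (hB e (hBS e he)) (Nat.lt_succ_of_le hl) (Nat.lt_succ_of_le hr)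
  exact hT.not_satisfies_idempotentIdentity hφ hw
    (hbasis _ (InvSemigroup.satisfies_idempotentIdentity hS) hT.Algebra hBT)

theorem mainTheorem6 (S : Type u) [Semigroup S] [StarMul S] (q r : ℕ)
    (hq : 1 ≤ q) (hr : 1 ≤ r)
    (hv : ∀ n : ℕ, 2 ≤ n →
      InvSemigroup.SatisfiesWords S (InvSemigroup.vWord n q r) (InvSemigroup.vWord n q r ^ 2))
    (hB : ∀ e : InvSemigroup.Identity,
      InvSemigroup.Satisfies S e → InvSemigroup.Satisfies InvSemigroup.Brandt e) :
    ¬ InvSemigroup.HasFiniteIdentityBasis.{u, v} S :=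
  mainTheorem6_general S
    ((Filter.eventually_atTop.2 ⟨2, fun n hn => ⟨q, hq, r, hv n hn⟩⟩).frequently) hB
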